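/- Work in $\mathbb R^n$. A \emph{weight} is a non-negative measurable function on $\mathbb R^n$ that is positive on a set of positive measure. Cubes have sides parallel to the coordinate axes. A \emph{Young function} is a continuous, convex, strictly increasing function $B:[0,\infty)\to[0,\infty)$ with $B(0)=0$ and $B(t)/t\to\infty$ as $t\to\infty$; its associate function is $\bar B(t)=\sup_{s>0}\{st-B(s)\}$. For $1<r<\infty$, write $r'=r/(r-1)$, and say that a function $\Phi$ on $[0,\infty)$ satisfies $\Phi\in B_r$ if $\int_1^\infty \frac{\Phi(t)}{t^r}\frac{dt}{t}<\infty$. For a cube $Q$ put $$\|f\|_{B,Q}=\inf\Big\{\lambda>0:\ \frac1{|Q|}\int_Q B\Big(\frac{|f(x)|}{\lambda}\Big)\,dx\le 1\Big\}$$ (with $\inf\emptyset=\infty$), and for weights $u,\sigma$ and Young functions $A,B$ put $$[u,\sigma]_{A^\alpha_{p,q,A,B}}=\sup_Q |Q|^{\frac{\alpha}{n}+\frac1q-\frac1p}\,\|u^{1/q}\|_{A,Q}\,\|\sigma^{1/p'}\|_{B,Q},$$ the supremum being over all cubes $Q$ (with $0\cdot\infty=0$). For $0<\alpha<n$ let $I_\alpha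 f(x)=\int_{\mathbb R^n}\frac{f(y)}{|x-y|^{n-\alpha}}\,dy$. \textbf{Theorem (conjoined bump condition for the fractional integral).} Let $0<\alpha<n$, $1<p\le q<\infty$, and let $A,B$ be Young functions with $\bar A\in B_{q'}$ and $\bar B\in B_p$. Then there is a finite constant $C=C(n,\alpha,p,q,A,B)$ such that for every pair of weights $(u,\sigma)$ with $[u,\sigma]_{A^\alpha_{p,q,A,B}}<\infty$ and every $f\in L^p(\sigma)$ (real- or complex-valued), the integral defining $I_\alpha(f\sigma)(x)$ converges absolutely for $u$-almost every $x$, $I_\alpha(f\sigma)\in L^q(u)$, and $$\left(\int_{\mathbb R^n}|I_\alpha(f\sigma)(x)|^q\,u(x)\,dx\right)^{1/q}\le C\,[u,\sigma]_{A^\alpha_{p,q,A,B}}\left(\int_{\mathbb R^n}|f(x)|^p\,\sigma(x)\,dx\right)^{1/p}.$$ -/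

import Mathlib

open MeasureTheory Set Filter Topology
open scoped ENNReal NNReal

noncomputable section

namespace FracBump

/-- A weight on `ℝⁿ`: a non-negative, (Lebesgue) measurable function that is positive on a set of
positive measure. -/
structure IsWeight {n : ℕ} (w : EuclideanSpace ℝ (Fin n) → ℝ) : Prop where
  nonneg : ∀ x, 0 ≤ w x
  aemeasurable : AEMeasurable w volume
  pos : 0 < volume {x | 0 < w x}

/-- The measure `w dx`. -/
def weightMeasure {n : ℕ} (w : EuclideanSpace ℝ (Fin n) → ℝ) :
    Measure (EuclideanSpace ℝ (Fin n)) :=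
  volume.withDensity fun x => ENNReal.ofReal (w x)

/-- The integrand `f(y) / |x - y|^(n - α)` of the fractional integral of `f` at `x`. -/
def fracKernel {n : ℕ} {𝕜 : Type*} [RCLike 𝕜] (α : ℝ) (f : EuclideanSpace ℝ (Fin n) → 𝕜)
    (x y : EuclideanSpace ℝ (Fin n)) : 𝕜 :=
  (‖x - y‖ ^ ((n : ℝ) - α))⁻¹ • f y

/-- The fractional integral `I_α f (x) = ∫ f(y) / |x - y|^(n - α) dy`. -/
def fracIntegral {n : ℕ} {𝕜 : Type*} [RCLike 𝕜] (α : ℝ) (f : EuclideanSpace ℝ (Fin n) → 𝕜)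
    (x : EuclideanSpace ℝ (Fin n)) : 𝕜 :=
  ∫ y, fracKernel α f x y

/-- The cube with sides parallel to the coordinate axes, lower corner `a` and side length `l`. -/
def cube {n : ℕ} (a : EuclideanSpace ℝ (Fin n)) (l : ℝ) : Set (EuclideanSpace ℝ (Fin n)) :=
  {x | ∀ i, x i ∈ Ico (a i) (a i + l)}

/-- Young functions `B : [0, ∞) → [0, ∞)`. Only the values on `[0, ∞)` matter. -/
structure IsYoung (B : ℝ → ℝ) : Prop where
  continuousOn : ContinuousOn B (Ici 0)
  convexOn : ConvexOn ℝ (Ici 0) B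
  strictMonoOn : StrictMonoOn B (Ici 0)
  map_zero : B 0 = 0
  tendsto_div : Tendsto (fun t => B t / t) atTop atTop

/-- The associate function `B̄(t) = sup_{s > 0} (s t - B(s))`. For a Young function `B` the
supremum is finite, because `B(s) / s → ∞`. -/
def associate (B : ℝ → ℝ) (t : ℝ) : ℝ :=
  sSup ((fun s => s * t - B s) '' Ioi 0)

/-- The `B_p` condition `∫_1^∞ B(t) / t^p dt/t < ∞`. -/
def SatisfiesBp (p : ℝ) (B : ℝ → ℝ) : Prop :=
  ∫⁻ t in Ioi (1 : ℝ), ENNReal.ofReal (B t / t ^ p / t) < ∞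

/-- The normalized Luxemburg norm of `f` on `Q`, with value `∞` if no `c > 0` is admissible. -/
def luxNorm {n : ℕ} (B : ℝ → ℝ) (Q : Set (EuclideanSpace ℝ (Fin n)))
    (f : EuclideanSpace ℝ (Fin n) → ℝ) : ℝ≥0∞ :=
  sInf {c : ℝ≥0∞ | ∃ r : ℝ, 0 < r ∧ c = ENNReal.ofReal r ∧
    (volume Q)⁻¹ * ∫⁻ x in Q, ENNReal.ofReal (B (|f x| / r)) ≤ 1}

/-- The conjoined bump constant: the supremum over all cubes `Q` of
`|Q|^(α/n + 1/q - 1/p) ‖u^(1/q)‖_{A,Q} ‖σ^(1/p')‖_{B,Q}`. -/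
def bumpConst {n : ℕ} (α p q : ℝ) (A B : ℝ → ℝ) (u σ : EuclideanSpace ℝ (Fin n) → ℝ) : ℝ≥0∞ :=
  ⨆ (a : EuclideanSpace ℝ (Fin n)) (l : ℝ) (_ : 0 < l),
    volume (cube a l) ^ (α / n + 1 / q - 1 / p)
      * luxNorm A (cube a l) (fun x => u x ^ (1 / q))
      * luxNorm B (cube a l) (fun x => σ x ^ (1 / p.conjExponent))

end FracBump

end

noncomputable section

namespace FracBump

variable {n : ℕ}

/-! By duality it suffices to bound the pairing of `I_α(fσ)` with `g u` for nonnegative `f`, `g`.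
Summing over dyadic cubes `Q` with `x ∈ Q` and `y ∈ 3Q` dominates the kernel (`ofReal_kernel_le`),
so the pairing is at most a constant times `∑_Q ℓ(Q)^α (∫_{3Q} fσ) ⟨gu⟩_Q`.

The sum is thinned to stopping cubes for the averages of `gu`. Every `Q` with nonzero average lies
in a stopping cube `P` with `⟨gu⟩_Q ≲ ⟨gu⟩_P` (`exists_stoppingCube`), and for fixed `P` the
quantities `ℓ(Q)^α ∫_{3Q} fσ`, `Q ⊆ P`, sum to a multiple of the one for `P`: triples of one level
overlap boundedly, and `α > 0` makes the levels a geometric series (`tsum_sub_le`).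

On each `3P`, write `σ = σ^(1/p') σ^(1/p)` and `u = u^(1/q) u^(1/q')` and apply Hölder in Orlicz
form. The factors `σ^(1/p')` and `u^(1/q)` are absorbed by the bump constant (`bump_term_le`), which
leaves `|P|^(1/p) ‖f σ^(1/p)‖_{B̄,3P}` times `|P|^(1/q') ‖g u^(1/q')‖_{Ā,3P}`. Hölder for series
separates these, using `q' ≤ p'`, that is `p ≤ q`.

Each stopping cube has a part of at least half its volume, and these parts overlap at most twice.
Hence the two series are controlled by integrals of Orlicz maximal functions
(`tsum_stoppingCubes_le`), and these are bounded on `L^p` and `L^(q')` because `B̄ ∈ B_p` and `Ā ∈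
B_{q'}` (`exists_lintegral_orlicz_rpow_le`). -/

/-! ### Dyadic cubes and their triples -/

theorem cube_eq_preimage (a : EuclideanSpace ℝ (Fin n)) (l : ℝ) :
    cube a l = (MeasurableEquiv.toLp 2 (Fin n → ℝ)).symm ⁻¹'
      (univ.pi fun i => Ico (a i) (a i + l)) := by
  ext x
  simp [cube]

theorem measurableSet_cube (a : EuclideanSpace ℝ (Fin n)) (l : ℝ) : MeasurableSet (cube a l) := by
  rw [cube_eq_preimage]
  exact (MeasurableEquiv.measurable _) (MeasurableSet.univ_pi fun i => measurableSet_Ico)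

theorem volume_cube (a : EuclideanSpace ℝ (Fin n)) (l : ℝ) :
    volume (cube a l) = ENNReal.ofReal l ^ n := by
  rw [cube_eq_preimage,
    (EuclideanSpace.volume_preserving_symm_measurableEquiv_toLp (Fin n)).measure_preimage
      (MeasurableSet.univ_pi fun i => measurableSet_Ico).nullMeasurableSet, Real.volume_pi_Ico]
  simp

/-- Indices of dyadic cubes: the pair `(k, m)` stands for the cube `2^k (m + [0, 1)ⁿ)`. -/
abbrev DyadicIndex (n : ℕ) := ℤ × (Fin n → ℤ)

/-- The side length of a dyadic cube. -/
def side (Q : DyadicIndex n) : ℝ := (2 : ℝ) ^ Q.1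

/-- The dyadic cube with index `Q`. -/
def dcube (Q : DyadicIndex n) : Set (EuclideanSpace ℝ (Fin n)) :=
  cube (WithLp.toLp 2 fun i => side Q * Q.2 i) (side Q)

/-- The concentric triple of a dyadic cube. -/
def tcube (Q : DyadicIndex n) : Set (EuclideanSpace ℝ (Fin n)) :=
  cube (WithLp.toLp 2 fun i => side Q * (Q.2 i - 1)) (3 * side Q)

theorem side_pos (Q : DyadicIndex n) : 0 < side Q := by unfold side; positivity

theorem measurableSet_dcube (Q : DyadicIndex n) : MeasurableSet (dcube Q) := measurableSet_cube _ _

theorem measurableSet_tcube (Q : DyadicIndex n) : MeasurableSet (tcube Q) := measurableSet_cube _ _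

theorem volume_dcube (Q : DyadicIndex n) : volume (dcube Q) = ENNReal.ofReal (side Q) ^ n :=
  volume_cube _ _

theorem volume_tcube (Q : DyadicIndex n) : volume (tcube Q) = 3 ^ n * volume (dcube Q) := by
  rw [volume_dcube, tcube, volume_cube, ENNReal.ofReal_mul (by norm_num), mul_pow]
  simp

theorem volume_dcube_ne_zero (Q : DyadicIndex n) : volume (dcube Q) ≠ 0 := by
  rw [volume_dcube]
  exact pow_ne_zero _ (by simpa using side_pos Q)

theorem volume_dcube_ne_top (Q : DyadicIndex n) : volume (dcube Q) ≠ ∞ := by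
  rw [volume_dcube]
  exact ENNReal.pow_ne_top ENNReal.ofReal_ne_top

theorem volume_tcube_ne_zero (Q : DyadicIndex n) : volume (tcube Q) ≠ 0 := by
  rw [volume_tcube]
  exact mul_ne_zero (by simp) (volume_dcube_ne_zero Q)

theorem volume_tcube_ne_top (Q : DyadicIndex n) : volume (tcube Q) ≠ ∞ := by
  rw [volume_tcube]
  exact ENNReal.mul_ne_top (by simp) (volume_dcube_ne_top Q)

theorem mem_dcube {Q : DyadicIndex n} {x : EuclideanSpace ℝ (Fin n)} :
    x ∈ dcube Q ↔ ∀ i, side Q * Q.2 i ≤ x i ∧ x i < side Q * (Q.2 i + 1) := by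
  simp only [dcube, cube, mem_ofPred_eq, mem_Ico]
  refine forall_congr' fun i => and_congr Iff.rfl ?_
  rw [mul_add, mul_one]

theorem mem_tcube {Q : DyadicIndex n} {x : EuclideanSpace ℝ (Fin n)} :
    x ∈ tcube Q ↔ ∀ i, side Q * (Q.2 i - 1) ≤ x i ∧ x i < side Q * (Q.2 i + 2) := by
  simp only [tcube, cube, mem_ofPred_eq, mem_Ico]
  refine forall_congr' fun i => and_congr Iff.rfl ?_
  rw [show side Q * ((Q.2 i : ℝ) - 1) + 3 * side Q = side Q * (Q.2 i + 2) by ring]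

theorem mem_dcube_iff_floor {Q : DyadicIndex n} {x : EuclideanSpace ℝ (Fin n)} :
    x ∈ dcube Q ↔ ∀ i, ⌊x i / side Q⌋ = Q.2 i := by
  rw [mem_dcube]
  refine forall_congr' fun i => ?_
  rw [Int.floor_eq_iff, le_div_iff₀ (side_pos Q), div_lt_iff₀ (side_pos Q), mul_comm (side Q),
    mul_comm (side Q)]

theorem mem_tcube_iff_floor {Q : DyadicIndex n} {x : EuclideanSpace ℝ (Fin n)} :
    x ∈ tcube Q ↔ ∀ i, Q.2 i - 1 ≤ ⌊x i / side Q⌋ ∧ ⌊x i / side Q⌋ ≤ Q.2 i + 1 := by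
  rw [mem_tcube]
  refine forall_congr' fun i => ?_
  rw [Int.le_floor, ← Int.lt_add_one_iff, Int.floor_lt, le_div_iff₀ (side_pos Q),
    div_lt_iff₀ (side_pos Q), mul_comm (side Q), mul_comm (side Q)]
  push_cast
  rw [add_assoc, one_add_one_eq_two]

theorem dcube_subset_tcube (Q : DyadicIndex n) : dcube Q ⊆ tcube Q := by
  intro x hx
  rw [mem_tcube_iff_floor]
  rw [mem_dcube_iff_floor] at hx
  intro i
  rw [hx i]
  omega

/-- The dyadic cube of level `k` that contains `x`. -/
def dyadicAt (k : ℤ) (x : EuclideanSpace ℝ (Fin n)) : DyadicIndex n :=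
  (k, fun i => ⌊x i / (2 : ℝ) ^ k⌋)

theorem mem_dcube_dyadicAt (k : ℤ) (x : EuclideanSpace ℝ (Fin n)) : x ∈ dcube (dyadicAt k x) := by
  rw [mem_dcube_iff_floor]
  intro i
  rfl

theorem eq_of_mem_dcube {Q P : DyadicIndex n} {x : EuclideanSpace ℝ (Fin n)} (hQ : x ∈ dcube Q)
    (hP : x ∈ dcube P) (h : Q.1 = P.1) : Q = P := by
  rw [mem_dcube_iff_floor] at hQ hP
  refine Prod.ext h (funext fun i => ?_)
  rw [← hQ i, ← hP i, side, side, h]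

/-- `Sub Q P` says that the dyadic cube `Q` is contained in the dyadic cube `P`. -/
def Sub (Q P : DyadicIndex n) : Prop :=
  Q.1 ≤ P.1 ∧ ∀ i, side P * P.2 i ≤ side Q * Q.2 i ∧ side Q * (Q.2 i + 1) ≤ side P * (P.2 i + 1)

theorem Sub.refl (Q : DyadicIndex n) : Sub Q Q := ⟨le_rfl, fun _ => ⟨le_rfl, le_rfl⟩⟩

theorem Sub.trans {Q P R : DyadicIndex n} (h : Sub Q P) (h' : Sub P R) : Sub Q R :=
  ⟨h.1.trans h'.1, fun i => ⟨(h'.2 i).1.trans (h.2 i).1, (h.2 i).2.trans (h'.2 i).2⟩⟩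

theorem side_le_side {Q P : DyadicIndex n} (h : Q.1 ≤ P.1) : side Q ≤ side P :=
  zpow_le_zpow_right₀ (by norm_num) h

theorem Sub.dcube_subset {Q P : DyadicIndex n} (h : Sub Q P) : dcube Q ⊆ dcube P := by
  intro x hx
  rw [mem_dcube] at hx ⊢
  exact fun i => ⟨(h.2 i).1.trans (hx i).1, (hx i).2.trans_le (h.2 i).2⟩

theorem Sub.tcube_subset {Q P : DyadicIndex n} (h : Sub Q P) : tcube Q ⊆ tcube P := by
  intro x hx
  rw [mem_tcube] at hx ⊢
  have hs := side_le_side h.1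
  intro i
  obtain ⟨h1, h2⟩ := h.2 i
  obtain ⟨h3, h4⟩ := hx i
  constructor <;> nlinarith

/-- The corners of `P` are integer multiples of `side Q`, so the strict inequalities supplied by the
common point sharpen to weak ones between corners. -/
theorem sub_of_mem {Q P : DyadicIndex n} {x : EuclideanSpace ℝ (Fin n)} (hQ : x ∈ dcube Q)
    (hP : x ∈ dcube P) (h : Q.1 ≤ P.1) : Sub Q P := by
  refine ⟨h, fun i => ?_⟩
  rw [mem_dcube] at hQ hP
  obtain ⟨h1, h2⟩ := hQ i
  obtain ⟨h3, h4⟩ := hP i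
  obtain ⟨j, hj⟩ := Int.eq_ofNat_of_zero_le (sub_nonneg.2 h)
  have hside : side P = side Q * ((2 ^ j : ℤ) : ℝ) := by
    have : P.1 = Q.1 + j := by omega
    unfold side
    rw [this, zpow_add₀ (by norm_num)]
    simp
  have hpos := side_pos Q
  rw [hside] at h3 h4 ⊢
  constructor
  · have h5 : side Q * (((2 ^ j * P.2 i : ℤ)) : ℝ) < side Q * ((Q.2 i + 1 : ℤ) : ℝ) := by
      push_cast at h3 ⊢; linarith
    have h6 := Int.lt_add_one_iff.1 (Int.cast_lt.1 (lt_of_mul_lt_mul_left h5 hpos.le))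
    have h7 : ((2 ^ j * P.2 i : ℤ) : ℝ) ≤ Q.2 i := Int.cast_le.2 h6
    rw [mul_assoc]
    refine mul_le_mul_of_nonneg_left ?_ hpos.le
    exact_mod_cast h7
  · have h5 : side Q * ((Q.2 i : ℤ) : ℝ) < side Q * (((2 ^ j * (P.2 i + 1) : ℤ)) : ℝ) := by
      push_cast at h4 ⊢; linarith
    have h6 := Int.add_one_le_iff.2 (Int.cast_lt.1 (lt_of_mul_lt_mul_left h5 hpos.le))
    have h7 : ((Q.2 i + 1 : ℤ) : ℝ) ≤ ((2 ^ j * (P.2 i + 1) : ℤ) : ℝ) := Int.cast_le.2 h6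
    rw [mul_assoc]
    refine mul_le_mul_of_nonneg_left ?_ hpos.le
    exact_mod_cast h7

theorem dcube_nonempty (Q : DyadicIndex n) : (dcube Q).Nonempty := by
  by_contra h
  rw [not_nonempty_iff_eq_empty] at h
  exact volume_dcube_ne_zero Q (by rw [h]; simp)

theorem Sub.eq_of_level {Q P : DyadicIndex n} (h : Sub Q P) (h' : Q.1 = P.1) : Q = P := by
  obtain ⟨x, hx⟩ := dcube_nonempty Q
  exact eq_of_mem_dcube hx (h.dcube_subset hx) h'

theorem sub_or_disjoint (Q P : DyadicIndex n) : Sub Q P ∨ Sub P Q ∨ Disjoint (dcube Q) (dcube P) := by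
  by_cases h : Disjoint (dcube Q) (dcube P)
  · exact Or.inr (Or.inr h)
  · obtain ⟨x, hx, hx'⟩ := Set.not_disjoint_iff.1 h
    rcases le_total Q.1 P.1 with h1 | h1
    · exact Or.inl (sub_of_mem hx hx' h1)
    · exact Or.inr (Or.inl (sub_of_mem hx' hx h1))

/-- The cubes of the level of `Q` that touch `Q`. -/
def neighbors (Q : DyadicIndex n) : Finset (DyadicIndex n) :=
  (Fintype.piFinset fun i => Finset.Icc (Q.2 i - 1) (Q.2 i + 1)).image fun m => (Q.1, m)

theorem mem_neighbors {Q R : DyadicIndex n} :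
    R ∈ neighbors Q ↔ R.1 = Q.1 ∧ ∀ i, Q.2 i - 1 ≤ R.2 i ∧ R.2 i ≤ Q.2 i + 1 := by
  obtain ⟨k, m⟩ := R
  simp only [neighbors, Finset.mem_image, Fintype.mem_piFinset, Finset.mem_Icc, Prod.mk.injEq]
  constructor
  · rintro ⟨m', h, rfl, rfl⟩
    exact ⟨rfl, h⟩
  · rintro ⟨rfl, h⟩
    exact ⟨m, h, rfl, rfl⟩

theorem card_neighbors (Q : DyadicIndex n) : (neighbors Q).card = 3 ^ n := by
  rw [neighbors, Finset.card_image_of_injective _ fun _ _ h => (Prod.ext_iff.1 h).2]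
  simp only [Fintype.card_piFinset, Int.card_Icc]
  simp [show ∀ a : ℤ, a + 1 + 1 - (a - 1) = 3 by intro a; ring]

theorem mem_neighbors_comm {Q R : DyadicIndex n} : R ∈ neighbors Q ↔ Q ∈ neighbors R := by
  simp only [mem_neighbors]
  constructor
  · rintro ⟨h, h'⟩
    exact ⟨h.symm, fun i => by have := h' i; omega⟩
  · rintro ⟨h, h'⟩
    exact ⟨h.symm, fun i => by have := h' i; omega⟩

theorem mem_tcube_iff_dyadicAt {Q : DyadicIndex n} {x : EuclideanSpace ℝ (Fin n)} :
    x ∈ tcube Q ↔ dyadicAt Q.1 x ∈ neighbors Q := by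
  rw [mem_tcube_iff_floor, mem_neighbors]
  simp [dyadicAt, side]

theorem tcube_eq_biUnion (Q : DyadicIndex n) : tcube Q = ⋃ R ∈ neighbors Q, dcube R := by
  ext x
  simp only [mem_iUnion, exists_prop]
  constructor
  · intro h
    exact ⟨_, mem_tcube_iff_dyadicAt.1 h, mem_dcube_dyadicAt _ _⟩
  · rintro ⟨R, hR, hx⟩
    rw [mem_tcube_iff_dyadicAt]
    rwa [eq_of_mem_dcube (mem_dcube_dyadicAt Q.1 x) hx (mem_neighbors.1 hR).1.symm]

theorem dcube_subset_tcube_of_mem_neighbors {Q R : DyadicIndex n} (h : R ∈ neighbors Q) :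
    dcube R ⊆ tcube Q := by
  rw [tcube_eq_biUnion]
  exact subset_biUnion_of_mem (u := fun R => dcube R) h

theorem volume_neighbor {Q R : DyadicIndex n} (h : R ∈ neighbors Q) :
    volume (dcube R) = volume (dcube Q) := by
  rw [volume_dcube, volume_dcube, side, side, (mem_neighbors.1 h).1]

/-- Touching is symmetric, so the cubes of level `k` whose triples contain `y` are the `3 ^ n`
neighbors of the cube containing `y`. -/
theorem tsum_indicator_tcube_le (k : ℤ) (y : EuclideanSpace ℝ (Fin n)) :
    ∑' m : Fin n → ℤ, (tcube (k, m)).indicator (1 : EuclideanSpace ℝ (Fin n) → ℝ≥0∞) y ≤ 3 ^ n := by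
  classical
  have h : ∀ m : Fin n → ℤ, (tcube (k, m)).indicator (1 : EuclideanSpace ℝ (Fin n) → ℝ≥0∞) y
      = if (k, m) ∈ neighbors (dyadicAt k y) then 1 else 0 := by
    intro m
    rw [Set.indicator_apply]
    refine if_congr ?_ rfl rfl
    rw [mem_tcube_iff_dyadicAt, mem_neighbors_comm]
  simp_rw [h]
  calc ∑' m : Fin n → ℤ, (if (k, m) ∈ neighbors (dyadicAt k y) then (1 : ℝ≥0∞) else 0)
      ≤ ∑' R : DyadicIndex n, (if R ∈ neighbors (dyadicAt k y) then (1 : ℝ≥0∞) else 0) :=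
        ENNReal.tsum_comp_le_tsum_of_injective
          (f := fun m : Fin n → ℤ => ((k, m) : DyadicIndex n)) (fun _ _ h => (Prod.ext_iff.1 h).2)
          (fun R => if R ∈ neighbors (dyadicAt k y) then (1 : ℝ≥0∞) else 0)
    _ = ∑ R ∈ neighbors (dyadicAt k y), (1 : ℝ≥0∞) := by
        rw [tsum_eq_sum (s := neighbors (dyadicAt k y)) (fun R hR => if_neg hR)]
        exact Finset.sum_congr rfl fun R hR => if_pos hR
    _ ≤ 3 ^ n := by simp [card_neighbors]

/-! ### Maximal cubes and the weak type estimate -/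

theorem exists_maximal_of_level_le {S : Set (DyadicIndex n)} {K : ℤ} (hK : ∀ R ∈ S, R.1 ≤ K)
    {Q : DyadicIndex n} (hQ : ∃ R ∈ S, Sub Q R) :
    ∃ P ∈ S, Sub Q P ∧ ∀ R ∈ S, Sub P R → R = P := by
  obtain ⟨R, hR, hQR⟩ := hQ
  obtain ⟨k, ⟨P, hP, hQP, rfl⟩, hmax⟩ := Int.exists_greatest_of_bdd
    (P := fun k => ∃ P ∈ S, Sub Q P ∧ P.1 = k)
    ⟨K, by rintro z ⟨P, hP, -, rfl⟩; exact hK P hP⟩ ⟨R.1, R, hR, hQR, rfl⟩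
  refine ⟨P, hP, hQP, fun R hR hPR => ?_⟩
  exact (hPR.eq_of_level (le_antisymm hPR.1 (hmax _ ⟨R, hR, hQP.trans hPR, rfl⟩))).symm

/-- For a nonnegative level `j`, `j ≤ 2^j ≤ (2^j)^n`, which is the volume. In dimension zero all
cubes have volume one, hence `n ≠ 0`. -/
theorem level_le_of_volume_le (hn : n ≠ 0) {c : ℝ≥0∞} (hc : c ≠ ∞) :
    ∃ K : ℤ, ∀ R : DyadicIndex n, volume (dcube R) ≤ c → R.1 ≤ K := by
  refine ⟨max 0 ⌈c.toReal⌉, fun R hR => ?_⟩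
  rcases le_total R.1 0 with h | h
  · exact h.trans (le_max_left _ _)
  · refine le_trans ?_ (le_max_right _ _)
    rw [volume_dcube] at hR
    have h1 : (1 : ℝ) ≤ side R := one_le_zpow₀ (by norm_num) h
    have h2 : ENNReal.ofReal (side R) ≤ c :=
      (le_self_pow₀ (by simpa using h1) hn).trans hR
    have h3 : side R ≤ c.toReal := (ENNReal.ofReal_le_iff_le_toReal hc).1 h2
    obtain ⟨j, hj⟩ := Int.eq_ofNat_of_zero_le h
    have h4 : (j : ℝ) ≤ side R := by
      rw [side, hj]
      have : j < 2 ^ j := Nat.lt_two_pow_self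
      simp only [zpow_natCast]
      exact_mod_cast this.le
    rw [hj]
    have h5 : ((j : ℤ) : ℝ) ≤ (⌈c.toReal⌉ : ℤ) := by
      push_cast
      exact (h4.trans h3).trans (Int.le_ceil _)
    exact_mod_cast h5

/-- The weak type `(1, 1)` estimate for triples of dyadic cubes. -/
theorem volume_biUnion_tcube_le (hn : n ≠ 0) (h : EuclideanSpace ℝ (Fin n) → ℝ≥0∞) {c : ℝ≥0∞}
    (hc : c ≠ 0) (hc' : c ≠ ∞) {S : Set (DyadicIndex n)}
    (hS : ∀ R ∈ S, c * volume (dcube R) ≤ ∫⁻ x in dcube R, h x) :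
    volume (⋃ R ∈ S, tcube R) ≤ 3 ^ n * (c⁻¹ * ∫⁻ x, h x) := by
  by_cases hh : ∫⁻ x, h x = ∞
  · rw [hh, ENNReal.mul_top (by simpa using hc'), ENNReal.mul_top (by simp)]
    exact le_top
  have hS' : ∀ R ∈ S, volume (dcube R) ≤ c⁻¹ * ∫⁻ x in dcube R, h x := by
    intro R hR
    rw [← ENNReal.div_eq_inv_mul, ENNReal.le_div_iff_mul_le (Or.inl hc) (Or.inl hc'), mul_comm]
    exact hS R hR
  obtain ⟨K, hK⟩ := level_le_of_volume_le (n := n) hn (c := c⁻¹ * ∫⁻ x, h x)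
    (ENNReal.mul_ne_top (ENNReal.inv_ne_top.2 hc) hh)
  have hSK : ∀ R ∈ S, R.1 ≤ K := fun R hR =>
    hK R ((hS' R hR).trans (by gcongr; exact Measure.restrict_le_self))
  -- The maximal cubes are pairwise disjoint, and their triples cover all the triples.
  set M : Set (DyadicIndex n) := {P ∈ S | ∀ R ∈ S, Sub P R → R = P} with hM
  have hdisj : Pairwise (Function.onFun Disjoint fun P : M => dcube P.1) := by
    intro P R hPR
    rcases sub_or_disjoint P.1 R.1 with h1 | h1 | h1
    · exact absurd (Subtype.ext (P.2.2 _ R.2.1 h1)).symm hPR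
    · exact absurd (Subtype.ext (R.2.2 _ P.2.1 h1)) hPR
    · exact h1
  calc volume (⋃ R ∈ S, tcube R) ≤ volume (⋃ P : M, tcube P.1) := by
        refine measure_mono (iUnion₂_subset fun R hR => ?_)
        obtain ⟨P, hP, hRP, hmax⟩ := exists_maximal_of_level_le hSK ⟨R, hR, Sub.refl R⟩
        exact hRP.tcube_subset.trans
          (subset_iUnion (fun P : M => tcube P.1) ⟨P, hP, hmax⟩)
    _ ≤ ∑' P : M, volume (tcube P.1) := measure_iUnion_le _
    _ ≤ ∑' P : M, 3 ^ n * (c⁻¹ * ∫⁻ x in dcube P.1, h x) := by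
        refine ENNReal.tsum_le_tsum fun P => ?_
        rw [volume_tcube]
        gcongr
        exact hS' _ P.2.1
    _ = 3 ^ n * (c⁻¹ * ∫⁻ x in ⋃ P : M, dcube P.1, h x) := by
        rw [lintegral_iUnion (fun P => measurableSet_dcube _) hdisj, ENNReal.tsum_mul_left,
          ENNReal.tsum_mul_left]
    _ ≤ 3 ^ n * (c⁻¹ * ∫⁻ x, h x) := by
        gcongr
        exact Measure.restrict_le_self

/-! ### Young functions and their associates -/

namespace IsYoung

variable {B : ℝ → ℝ}

theorem nonneg (hB : IsYoung B) {t : ℝ} (ht : 0 ≤ t) : 0 ≤ B t := by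
  rw [← hB.map_zero]
  exact hB.strictMonoOn.monotoneOn self_mem_Ici ht ht

theorem bddAbove (hB : IsYoung B) (t : ℝ) : BddAbove ((fun s => s * t - B s) '' Ioi 0) := by
  obtain ⟨S, hS⟩ := eventually_atTop.1 (hB.tendsto_div.eventually_ge_atTop t)
  refine ⟨|S| * |t|, ?_⟩
  rintro _ ⟨s, hs, rfl⟩
  have hs : 0 < s := hs
  have hBs := hB.nonneg hs.le
  rcases le_total S s with h | h
  · have h1 := (le_div_iff₀ hs).1 (hS s h)
    have : 0 ≤ |S| * |t| := by positivity
    simp only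
    linarith
  · have h1 : s * t ≤ |S| * |t| := by
      refine (mul_le_mul_of_nonneg_left (le_abs_self t) hs.le).trans ?_
      exact mul_le_mul_of_nonneg_right (h.trans (le_abs_self S)) (abs_nonneg t)
    simp only
    linarith

theorem le_associate (hB : IsYoung B) (t : ℝ) {s : ℝ} (hs : 0 < s) :
    s * t - B s ≤ associate B t :=
  le_csSup (hB.bddAbove t) ⟨s, hs, rfl⟩

theorem associate_le {t c : ℝ} (h : ∀ s, 0 < s → s * t - B s ≤ c) : associate B t ≤ c := by
  refine csSup_le ⟨_, 1, mem_Ioi.2 one_pos, rfl⟩ ?_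
  rintro _ ⟨s, hs, rfl⟩
  exact h s hs

theorem associate_nonneg (hB : IsYoung B) (t : ℝ) : 0 ≤ associate B t := by
  have h : Tendsto (fun s => s * t - B s) (𝓝[>] 0) (𝓝 (0 * t - B 0)) :=
    (((continuous_id.mul continuous_const).tendsto 0).mono_left nhdsWithin_le_nhds).sub
      ((hB.continuousOn 0 self_mem_Ici).mono_left (nhdsWithin_mono _ Ioi_subset_Ici_self))
  rw [hB.map_zero, zero_mul, sub_zero] at h
  exact le_of_tendsto h (eventually_nhdsWithin_of_forall fun s hs => hB.le_associate t hs)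

theorem associate_mono (hB : IsYoung B) : Monotone (associate B) := fun _ t' h =>
  associate_le fun _ hs =>
    (sub_le_sub_right (mul_le_mul_of_nonneg_left h hs.le) _).trans (hB.le_associate t' hs)

/-- Because `B ≥ 0`, `s ε t - B s ≤ ε (s t - B s)` for `ε ≤ 1`. -/
theorem associate_mul_le (hB : IsYoung B) (t : ℝ) {ε : ℝ} (h0 : 0 ≤ ε) (h1 : ε ≤ 1) :
    associate B (ε * t) ≤ ε * associate B t := associate_le fun s hs => by
  have h2 := mul_le_mul_of_nonneg_left (hB.le_associate t hs) h0
  have h3 := mul_le_mul_of_nonneg_right h1 (hB.nonneg hs.le)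
  linarith

theorem mul_le_add_associate (hB : IsYoung B) {s t : ℝ} (hs : 0 ≤ s) :
    s * t ≤ B s + associate B t := by
  rcases hs.eq_or_lt with rfl | hs
  · rw [zero_mul, hB.map_zero, zero_add]
    exact hB.associate_nonneg t
  · linarith [hB.le_associate t hs]

/-- Supplies the threshold below which values of a function are harmless in the weak type estimate
for the Orlicz maximal function. -/
theorem exists_associate_le_half (hB : IsYoung B) :
    ∃ s : ℝ, 0 < s ∧ associate B s ≤ 1 / 2 := by
  have h := hB.associate_nonneg 1
  refine ⟨(2 * (1 + associate B 1))⁻¹, by positivity, ?_⟩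
  have := hB.associate_mul_le 1 (ε := (2 * (1 + associate B 1))⁻¹) (by positivity)
    (inv_le_one_of_one_le₀ (by linarith))
  rw [mul_one] at this
  refine this.trans ?_
  rw [inv_mul_le_iff₀ (by positivity)]
  linarith

end IsYoung

/-! ### Luxemburg norms and Hölder's inequality -/

theorem exists_of_luxNorm_lt {Φ : ℝ → ℝ} {Q : Set (EuclideanSpace ℝ (Fin n))}
    {f : EuclideanSpace ℝ (Fin n) → ℝ} {c : ℝ≥0∞} (h : luxNorm Φ Q f < c) :
    ∃ r : ℝ, 0 < r ∧ ENNReal.ofReal r < c ∧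
      (volume Q)⁻¹ * ∫⁻ x in Q, ENNReal.ofReal (Φ (|f x| / r)) ≤ 1 := by
  obtain ⟨_, ⟨r, hr, rfl, h'⟩, hlt⟩ := sInf_lt_iff.1 h
  exact ⟨r, hr, hlt, h'⟩

theorem lt_of_lt_luxNorm {Φ : ℝ → ℝ} {Q : Set (EuclideanSpace ℝ (Fin n))}
    {f : EuclideanSpace ℝ (Fin n) → ℝ} {r : ℝ} (hr : 0 < r)
    (h : ENNReal.ofReal r < luxNorm Φ Q f) :
    1 < (volume Q)⁻¹ * ∫⁻ x in Q, ENNReal.ofReal (Φ (|f x| / r)) := by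
  by_contra! h'
  exact h.not_ge (sInf_le ⟨r, hr, rfl, h'⟩)

/-- At least linear growth of `Φ` makes the Luxemburg norm control the `L^1` average. This settles
the case `0 * ∞` in Hölder's inequality. -/
theorem ae_eq_zero_of_luxNorm_eq_zero {Φ : ℝ → ℝ} {K : ℝ} (hΦ : ∀ t, 0 ≤ t → t ≤ Φ t + K)
    {Q : Set (EuclideanSpace ℝ (Fin n))} (hQ : volume Q ≠ 0) (hQ' : volume Q ≠ ∞)
    {f : EuclideanSpace ℝ (Fin n) → ℝ} (hf : Measurable f) (h : luxNorm Φ Q f = 0) :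
    ∀ᵐ x ∂volume.restrict Q, f x = 0 := by
  have key : ∀ c : ℝ≥0∞, 0 < c → ∫⁻ x in Q, ENNReal.ofReal |f x| ≤
      c * (volume Q * (1 + ENNReal.ofReal K)) := by
    intro c hc
    obtain ⟨r, hr, hrc, hle⟩ := exists_of_luxNorm_lt (h.trans_lt hc)
    have hle' : ∫⁻ x in Q, ENNReal.ofReal (Φ (|f x| / r)) ≤ volume Q := by
      rwa [← ENNReal.div_eq_inv_mul, ENNReal.div_le_iff hQ hQ', one_mul] at hle
    calc ∫⁻ x in Q, ENNReal.ofReal |f x|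
        ≤ ∫⁻ x in Q, ENNReal.ofReal r *
            (ENNReal.ofReal (Φ (|f x| / r)) + ENNReal.ofReal K) := by
          refine lintegral_mono fun x => ?_
          calc ENNReal.ofReal |f x| = ENNReal.ofReal r * ENNReal.ofReal (|f x| / r) := by
                rw [← ENNReal.ofReal_mul hr.le, mul_div_cancel₀ _ hr.ne']
            _ ≤ _ := by
                gcongr
                exact (ENNReal.ofReal_le_ofReal (hΦ _ (by positivity))).trans
                  ENNReal.ofReal_add_le
      _ = ENNReal.ofReal r * ((∫⁻ x in Q, ENNReal.ofReal (Φ (|f x| / r))) +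
            ENNReal.ofReal K * volume Q) := by
          rw [lintegral_const_mul' _ _ ENNReal.ofReal_ne_top,
            lintegral_add_right _ measurable_const, setLIntegral_const]
      _ ≤ c * (volume Q * (1 + ENNReal.ofReal K)) := by
          rw [mul_add (volume Q), mul_one, mul_comm (volume Q)]
          gcongr
  have hzero : ∫⁻ x in Q, ENNReal.ofReal |f x| = 0 := by
    have hX : volume Q * (1 + ENNReal.ofReal K) ≠ ∞ := ENNReal.mul_ne_top hQ' (by simp)
    have hX0 : volume Q * (1 + ENNReal.ofReal K) ≠ 0 := mul_ne_zero hQ (by simp)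
    by_contra hne
    obtain ⟨d, hd0, hd⟩ := ENNReal.lt_iff_exists_nnreal_btwn.1 (pos_iff_ne_zero.2 hne)
    have := key (d / (volume Q * (1 + ENNReal.ofReal K))) (ENNReal.div_pos hd0.ne' hX)
    rw [ENNReal.div_mul_cancel hX0 hX] at this
    exact absurd hd (not_lt.2 this)
  rw [lintegral_eq_zero_iff (by fun_prop)] at hzero
  filter_upwards [hzero] with x hx
  simpa using hx

/-- Hölder's inequality for Luxemburg norms. -/
theorem lintegral_mul_le_luxNorm {Φ Ψ : ℝ → ℝ} (hΨ : Measurable Ψ)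
    (hΦΨ : ∀ s t, 0 ≤ s → 0 ≤ t → s * t ≤ Φ s + Ψ t)
    {Q : Set (EuclideanSpace ℝ (Fin n))} (hQ : volume Q ≠ 0) (hQ' : volume Q ≠ ∞)
    {f g : EuclideanSpace ℝ (Fin n) → ℝ} (hf : Measurable f) (hg : Measurable g) :
    ∫⁻ x in Q, ENNReal.ofReal (|f x| * |g x|) ≤
      2 * volume Q * (luxNorm Φ Q f * luxNorm Ψ Q g) := by
  have hzero : (∀ᵐ x ∂volume.restrict Q, |f x| * |g x| = 0) →
      ∫⁻ x in Q, ENNReal.ofReal (|f x| * |g x|) ≤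
      2 * volume Q * (luxNorm Φ Q f * luxNorm Ψ Q g) := by
    intro h
    refine le_of_eq_of_le ?_ zero_le
    rw [lintegral_congr_ae (g := 0) (by filter_upwards [h] with x hx; simp [hx])]
    simp
  by_cases h1 : luxNorm Φ Q f = 0
  · refine hzero ?_
    filter_upwards [ae_eq_zero_of_luxNorm_eq_zero (Φ := Φ) (K := Ψ 1)
      (fun t ht => by simpa using hΦΨ t 1 ht zero_le_one) hQ hQ' hf h1] with x hx
    simp [hx]
  by_cases h2 : luxNorm Ψ Q g = 0
  · refine hzero ?_
    filter_upwards [ae_eq_zero_of_luxNorm_eq_zero (Φ := Ψ) (K := Φ 1)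
      (fun t ht => by simpa [add_comm] using hΦΨ 1 t zero_le_one ht) hQ hQ' hg h2] with x hx
    simp [hx]
  have h20 : 2 * volume Q ≠ 0 := mul_ne_zero (by simp) hQ
  have h2t : 2 * volume Q ≠ ∞ := ENNReal.mul_ne_top (by simp) hQ'
  rw [mul_comm, ← ENNReal.div_le_iff h20 h2t]
  -- Both norms being nonzero, their product can be approached by products of larger admissible
  -- constants, also when a norm is infinite.
  refine ENNReal.le_mul_of_forall_lt (Or.inl h1) (Or.inr h2) fun c hc d hd => ?_
  rw [ENNReal.div_le_iff h20 h2t]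
  obtain ⟨r, hr, hrc, hle⟩ := exists_of_luxNorm_lt hc
  obtain ⟨s, hs, hsd, hle2⟩ := exists_of_luxNorm_lt hd
  rw [← ENNReal.div_eq_inv_mul, ENNReal.div_le_iff hQ hQ', one_mul] at hle hle2
  calc ∫⁻ x in Q, ENNReal.ofReal (|f x| * |g x|)
      ≤ ∫⁻ x in Q, ENNReal.ofReal r * ENNReal.ofReal s *
          (ENNReal.ofReal (Φ (|f x| / r)) + ENNReal.ofReal (Ψ (|g x| / s))) := by
        refine lintegral_mono fun x => ?_
        calc ENNReal.ofReal (|f x| * |g x|)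
            = ENNReal.ofReal r * ENNReal.ofReal s *
              ENNReal.ofReal ((|f x| / r) * (|g x| / s)) := by
              rw [← ENNReal.ofReal_mul hr.le, ← ENNReal.ofReal_mul (by positivity)]
              congr 1
              field_simp
          _ ≤ _ := by
              gcongr
              exact (ENNReal.ofReal_le_ofReal (hΦΨ _ _ (by positivity) (by positivity))).trans
                ENNReal.ofReal_add_le
    _ = ENNReal.ofReal r * ENNReal.ofReal s * ((∫⁻ x in Q, ENNReal.ofReal (Φ (|f x| / r))) +
          ∫⁻ x in Q, ENNReal.ofReal (Ψ (|g x| / s))) := by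
        rw [lintegral_const_mul' _ _ (ENNReal.mul_ne_top ENNReal.ofReal_ne_top
          ENNReal.ofReal_ne_top), lintegral_add_right _ (by fun_prop)]
    _ ≤ c * d * (2 * volume Q) := by
        rw [two_mul]
        gcongr

/-! ### The dyadic Orlicz maximal function -/

/-- The dyadic supremum `sup_{P ∋ x} c P`. -/
def dyadicSup (c : DyadicIndex n → ℝ≥0∞) (x : EuclideanSpace ℝ (Fin n)) : ℝ≥0∞ :=
  ⨆ P, (dcube P).indicator (fun _ => c P) x

theorem measurable_dyadicSup (c : DyadicIndex n → ℝ≥0∞) : Measurable (dyadicSup c) :=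
  Measurable.iSup fun P => measurable_const.indicator (measurableSet_dcube P)

theorem le_dyadicSup (c : DyadicIndex n → ℝ≥0∞) {P : DyadicIndex n}
    {x : EuclideanSpace ℝ (Fin n)} (hx : x ∈ dcube P) : c P ≤ dyadicSup c x :=
  (indicator_of_mem hx (fun _ => c P)).ge.trans
    (le_iSup (fun P => (dcube P).indicator (fun _ => c P) x) P)

theorem exists_of_lt_dyadicSup {c : DyadicIndex n → ℝ≥0∞} {b : ℝ≥0∞}
    {x : EuclideanSpace ℝ (Fin n)} (h : b < dyadicSup c x) : ∃ P, x ∈ dcube P ∧ b < c P := by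
  obtain ⟨P, hP⟩ := lt_iSup_iff.1 h
  have hx : x ∈ dcube P := by
    by_contra hx
    rw [indicator_of_notMem hx] at hP
    exact not_lt_zero hP
  rw [indicator_of_mem hx] at hP
  exact ⟨P, hx, hP⟩

/-- The weak type estimate for the dyadic Orlicz maximal function. -/
theorem volume_lt_orlicz_le (hn : n ≠ 0) {Φ : ℝ → ℝ} (hΦ : Monotone Φ) {s : ℝ}
    (hs : Φ s ≤ 1 / 2) (F : EuclideanSpace ℝ (Fin n) → ℝ) {t : ℝ} (ht : 0 < t) :
    volume {x | ENNReal.ofReal t < dyadicSup (fun P => luxNorm Φ (tcube P) F) x} ≤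
      2 * 3 ^ n * ∫⁻ x, {x | s * t < |F x|}.indicator
        (fun x => ENNReal.ofReal (Φ (|F x| / t))) x := by
  set h : EuclideanSpace ℝ (Fin n) → ℝ≥0∞ := fun x => {x | s * t < |F x|}.indicator
        (fun x => ENNReal.ofReal (Φ (|F x| / t))) x with hh
  -- Where `|F| ≤ s t`, monotonicity and the choice of `s` give `Φ (|F| / t) ≤ 1 / 2`; only larger
  -- values enter `h`.
  have hle : ∀ x, ENNReal.ofReal (Φ (|F x| / t)) ≤ h x + 2⁻¹ := by
    intro x
    by_cases hx : s * t < |F x|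
    · have : h x = ENNReal.ofReal (Φ (|F x| / t)) :=
        indicator_of_mem (show x ∈ {x | s * t < |F x|} from hx) _
      rw [this]
      exact le_self_add
    · have h1 : |F x| / t ≤ s := (div_le_iff₀ ht).2 (not_lt.1 hx)
      refine le_trans ?_ le_add_self
      have h2 : Φ (|F x| / t) ≤ 2⁻¹ := (hΦ h1).trans (by simpa using hs)
      refine (ENNReal.ofReal_le_ofReal h2).trans ?_
      rw [ENNReal.ofReal_inv_of_pos two_pos]
      simp
  set S : Set (DyadicIndex n) := {R | 2⁻¹ * volume (dcube R) ≤ ∫⁻ x in dcube R, h x} with hS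
  have hsub : {x | ENNReal.ofReal t < dyadicSup (fun P => luxNorm Φ (tcube P) F) x} ⊆
      ⋃ R ∈ S, tcube R := by
    intro x hx
    obtain ⟨P, hxP, hP⟩ := exists_of_lt_dyadicSup hx
    have h1 := lt_of_lt_luxNorm ht hP
    rw [← ENNReal.div_eq_inv_mul, ENNReal.lt_div_iff_mul_lt (Or.inl (volume_tcube_ne_zero P))
      (Or.inl (volume_tcube_ne_top P)), one_mul] at h1
    -- The triple of `P` is made of `3 ^ n` cubes of equal volume. If `h` averaged below `1 / 2` on
    -- all of them, `Φ (|F| / t)` would average at most `1 / 2 + 1 / 2 = 1` on the triple.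
    obtain ⟨R, hR, hRS⟩ : ∃ R ∈ neighbors P, R ∈ S := by
      by_contra! hno
      have h2 : ∫⁻ x in tcube P, ENNReal.ofReal (Φ (|F x| / t)) ≤ volume (tcube P) := by
        calc ∫⁻ x in tcube P, ENNReal.ofReal (Φ (|F x| / t))
            ≤ ∫⁻ x in tcube P, (h x + 2⁻¹) := lintegral_mono fun x => hle x
          _ = (∫⁻ x in tcube P, h x) + 2⁻¹ * volume (tcube P) := by
              rw [lintegral_add_right _ measurable_const, setLIntegral_const]
          _ ≤ (∑ R ∈ neighbors P, ∫⁻ x in dcube R, h x) + 2⁻¹ * volume (tcube P) := by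
              gcongr
              rw [tcube_eq_biUnion, ← Finset.tsum_subtype]
              have : ⋃ R ∈ neighbors P, dcube R = ⋃ R : neighbors P, dcube R.1 := by
                rw [iUnion_subtype]
              rw [this]
              exact lintegral_iUnion_le _ _
          _ ≤ (∑ R ∈ neighbors P, 2⁻¹ * volume (dcube P)) + 2⁻¹ * volume (tcube P) := by
              gcongr with R hR
              rw [← volume_neighbor hR]
              exact (not_le.1 (hno R hR)).le
          _ = volume (tcube P) := by
              rw [Finset.sum_const, card_neighbors, nsmul_eq_mul, volume_tcube]
              push_cast
              rw [mul_left_comm, ← add_mul, ENNReal.inv_two_add_inv_two, one_mul]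
      exact absurd h1 (not_lt.2 h2)
    refine mem_iUnion₂.2 ⟨R, hRS, ?_⟩
    exact dcube_subset_tcube_of_mem_neighbors (mem_neighbors_comm.1 hR) hxP
  refine (measure_mono hsub).trans ((volume_biUnion_tcube_le hn h (c := 2⁻¹) (by simp) (by simp)
    fun R hR => hR).trans (le_of_eq ?_))
  rw [inv_inv]
  ring

/-- The substitution `t ↦ v / t` carries `0 < t < v / s` to `(s, ∞)` and produces the `B_p` integral
of `Φ`. -/
theorem lintegral_comp_div_mul_rpow_le (Φ : ℝ → ℝ) (p : ℝ) {s : ℝ} (hs : 0 < s) {v : ℝ}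
    (hv : 0 ≤ v) :
    ∫⁻ t in Ioi (0 : ℝ), {t | s * t < v}.indicator
        (fun t => ENNReal.ofReal (Φ (v / t)) * ENNReal.ofReal (t ^ (p - 1))) t ≤
      ENNReal.ofReal (v ^ p) * ∫⁻ t in Ioi s, ENNReal.ofReal (Φ t / t ^ p / t) := by
  rcases hv.eq_or_lt with rfl | hv
  · refine le_of_eq_of_le ?_ zero_le
    rw [setLIntegral_congr_fun (g := 0) measurableSet_Ioi]
    · simp
    · intro t ht
      refine indicator_of_notMem ?_ _
      simp only [mem_ofPred_eq, not_lt]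
      exact (mul_pos hs ht).le
  have himage : (fun t => v / t) '' Ioi s = Ioo 0 (v / s) := by
    ext y
    simp only [mem_image, mem_Ioi, mem_Ioo]
    constructor
    · rintro ⟨t, ht, rfl⟩
      exact ⟨div_pos hv (hs.trans ht), div_lt_div_of_pos_left hv hs ht⟩
    · rintro ⟨h1, h2⟩
      refine ⟨v / y, ?_, by field_simp⟩
      rw [lt_div_iff₀ h1]
      rw [lt_div_iff₀ hs] at h2
      linarith
  have hset : {t | s * t < v} = Iio (v / s) := by
    ext t
    simp only [mem_ofPred_eq, mem_Iio]
    rw [lt_div_iff₀ hs, mul_comm]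
  rw [hset, setLIntegral_indicator measurableSet_Iio, Iio_inter_Ioi, ← himage,
    lintegral_image_eq_lintegral_abs_deriv_mul (f' := fun t => -v / t ^ 2) measurableSet_Ioi,
    ← lintegral_const_mul' _ _ ENNReal.ofReal_ne_top]
  · refine (setLIntegral_congr_fun measurableSet_Ioi fun t ht => ?_).le
    have ht : 0 < t := hs.trans ht
    rw [← mul_assoc, mul_right_comm, ← ENNReal.ofReal_mul (abs_nonneg _),
      ← ENNReal.ofReal_mul (by positivity), ← ENNReal.ofReal_mul (by positivity)]
    congr 1
    have : v / (v / t) = t := by field_simp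
    rw [this, Real.div_rpow hv.le ht.le, Real.rpow_sub_one hv.ne', Real.rpow_sub_one ht.ne', abs_div,
      abs_neg, abs_of_pos hv, abs_of_pos (by positivity)]
    have := Real.rpow_pos_of_pos ht p
    field_simp
  · intro t ht
    have ht : t ≠ 0 := (hs.trans ht).ne'
    have := (hasDerivAt_inv ht).const_mul v
    refine (this.congr_deriv ?_).hasDerivWithinAt
    field_simp
  · intro t ht t' ht' h
    have ht : t ≠ 0 := (hs.trans ht).ne'
    have ht' : t' ≠ 0 := (hs.trans ht').ne'
    simp only at h
    field_simp at h
    exact h.symm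

/-- The `B_p` condition only sees `(1, ∞)`; on `(s, 1]` the integrand is bounded because `s > 0`. -/
theorem lintegral_Ioi_lt_top {Φ : ℝ → ℝ} (hΦ : Monotone Φ) (hΦ0 : ∀ t, 0 ≤ Φ t) {p : ℝ}
    (hp : 0 < p) (h : SatisfiesBp p Φ) {s : ℝ} (hs : 0 < s) :
    ∫⁻ t in Ioi s, ENNReal.ofReal (Φ t / t ^ p / t) < ∞ := by
  have hsub : Ioi s ⊆ Ioc s 1 ∪ Ioi 1 := fun t ht => by
    rcases le_or_gt t 1 with h | h
    · exact Or.inl ⟨ht, h⟩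
    · exact Or.inr h
  refine (lintegral_mono_set hsub).trans_lt ((lintegral_union_le _ _ _).trans_lt
    (ENNReal.add_lt_top.2 ⟨?_, h⟩))
  calc ∫⁻ t in Ioc s 1, ENNReal.ofReal (Φ t / t ^ p / t)
      ≤ ∫⁻ t in Ioc s 1, ENNReal.ofReal (Φ 1 / s ^ p / s) := by
        refine setLIntegral_mono measurable_const fun t ht => ENNReal.ofReal_le_ofReal ?_
        have := Real.rpow_pos_of_pos hs p
        have h1 := hΦ0 1
        have h2 := hΦ0 t
        gcongr
        · exact hΦ ht.2
        · exact ht.1.le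
        · exact ht.1.le
    _ < ∞ := by
        rw [setLIntegral_const]
        exact ENNReal.mul_lt_top ENNReal.ofReal_lt_top (by simp)

/-- The strong type estimate for the dyadic Orlicz maximal function. -/
theorem exists_lintegral_orlicz_rpow_le (hn : n ≠ 0) {Φ : ℝ → ℝ} (hΦ : Monotone Φ)
    (hΦ0 : ∀ t, 0 ≤ Φ t) {s : ℝ} (hs0 : 0 < s) (hs : Φ s ≤ 1 / 2) {p : ℝ} (hp : 0 < p)
    (hBp : SatisfiesBp p Φ) :
    ∃ C : ℝ≥0, ∀ F : EuclideanSpace ℝ (Fin n) → ℝ, Measurable F →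
      ∫⁻ x, dyadicSup (fun P => luxNorm Φ (tcube P) F) x ^ p ≤
        C * ∫⁻ x, ENNReal.ofReal (|F x| ^ p) := by
  set K := ∫⁻ t in Ioi s, ENNReal.ofReal (Φ t / t ^ p / t) with hK
  have hKtop : K < ∞ := lintegral_Ioi_lt_top hΦ hΦ0 hp hBp hs0
  have hCtop : ENNReal.ofReal p * (2 * 3 ^ n * K) ≠ ∞ := by finiteness
  refine ⟨(ENNReal.ofReal p * (2 * 3 ^ n * K)).toNNReal, fun F hF => ?_⟩
  rw [ENNReal.coe_toNNReal hCtop]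
  set M := dyadicSup (fun P => luxNorm Φ (tcube P) F) with hM
  have hMm : Measurable M := measurable_dyadicSup _
  -- The layer cake formula is for real-valued functions, and `M` may be infinite. Monotone
  -- convergence removes the truncation.
  have htrunc : ∀ N : ℕ, ∫⁻ x, (min (M x) N) ^ p ≤
      ENNReal.ofReal p * (2 * 3 ^ n * K) * ∫⁻ x, ENNReal.ofReal (|F x| ^ p) := by
    intro N
    have hfin : ∀ x, min (M x) N ≠ ∞ := fun x =>
      ((min_le_right _ _).trans_lt (ENNReal.natCast_lt_top N)).ne
    calc ∫⁻ x, (min (M x) N) ^ p = ∫⁻ x, ENNReal.ofReal ((min (M x) N).toReal ^ p) := by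
          refine lintegral_congr fun x => ?_
          rw [← ENNReal.ofReal_rpow_of_nonneg ENNReal.toReal_nonneg hp.le,
            ENNReal.ofReal_toReal (hfin x)]
      _ = ENNReal.ofReal p * ∫⁻ t in Ioi (0 : ℝ), volume {x | t < (min (M x) N).toReal} *
            ENNReal.ofReal (t ^ (p - 1)) :=
          lintegral_rpow_eq_lintegral_meas_lt_mul _ (ae_of_all _ fun x => ENNReal.toReal_nonneg)
            (hMm.min measurable_const).ennreal_toReal.aemeasurable hp
      _ ≤ ENNReal.ofReal p * ∫⁻ t in Ioi (0 : ℝ), 2 * 3 ^ n * ∫⁻ x, {t | s * t < |F x|}.indicator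
            (fun t => ENNReal.ofReal (Φ (|F x| / t)) * ENNReal.ofReal (t ^ (p - 1))) t := by
          refine mul_le_mul_right (setLIntegral_mono' measurableSet_Ioi fun t ht => ?_) _
          have hsub : {x | t < (min (M x) N).toReal} ⊆ {x | ENNReal.ofReal t < M x} :=
            fun x hx => ((ENNReal.ofReal_lt_iff_lt_toReal (le_of_lt ht) (hfin x)).2 hx).trans_le
              (min_le_left _ _)
          refine (mul_le_mul_left ((measure_mono hsub).trans
            (volume_lt_orlicz_le hn hΦ hs F ht)) _).trans (le_of_eq ?_)
          rw [mul_assoc, ← lintegral_mul_const' _ _ ENNReal.ofReal_ne_top]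
          congr 1
          refine lintegral_congr fun x => ?_
          simp only [indicator_apply, mem_ofPred_eq]
          split_ifs <;> simp
      _ = ENNReal.ofReal p * (2 * 3 ^ n * ∫⁻ x, ∫⁻ t in Ioi (0 : ℝ), {t | s * t < |F x|}.indicator
            (fun t => ENNReal.ofReal (Φ (|F x| / t)) * ENNReal.ofReal (t ^ (p - 1))) t) := by
          rw [lintegral_const_mul' _ _ (by finiteness), lintegral_lintegral_swap]
          refine Measurable.aemeasurable ?_
          have hΦm := hΦ.measurable
          have : MeasurableSet {z : ℝ × EuclideanSpace ℝ (Fin n) | s * z.1 < |F z.2|} :=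
            measurableSet_lt (by fun_prop) (by fun_prop)
          exact Measurable.indicator (f := fun z : ℝ × EuclideanSpace ℝ (Fin n) =>
            ENNReal.ofReal (Φ (|F z.2| / z.1)) * ENNReal.ofReal (z.1 ^ (p - 1)))
            (by fun_prop) this
      _ ≤ ENNReal.ofReal p * (2 * 3 ^ n * ∫⁻ x, ENNReal.ofReal (|F x| ^ p) * K) := by
          gcongr with x
          exact lintegral_comp_div_mul_rpow_le Φ p hs0 (abs_nonneg _)
      _ = _ := by
          rw [lintegral_mul_const' _ _ hKtop.ne]
          ring
  have hlim : Tendsto (fun N : ℕ => ∫⁻ x, (min (M x) N) ^ p) atTop (𝓝 (∫⁻ x, M x ^ p)) := by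
    refine lintegral_tendsto_of_tendsto_of_monotone (fun N => by fun_prop)
      (ae_of_all _ fun x N N' h => ?_) (ae_of_all _ fun x => ?_)
    · dsimp only
      gcongr
    · have h1 : Tendsto (fun N : ℕ => min (M x) (N : ℝ≥0∞)) atTop (𝓝 (min (M x) ∞)) :=
        tendsto_const_nhds.min ENNReal.tendsto_nat_nhds_top
      rw [min_eq_left le_top] at h1
      exact (ENNReal.continuous_rpow_const.tendsto _).comp h1
  exact le_of_tendsto' hlim htrunc

/-! ### Stopping cubes and the Carleson embedding -/

/-- The average of `w` over a dyadic cube. -/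
def dyadicAvg (w : EuclideanSpace ℝ (Fin n) → ℝ≥0∞) (Q : DyadicIndex n) : ℝ≥0∞ :=
  (∫⁻ x in dcube Q, w x) / volume (dcube Q)

/-- The ratio of consecutive levels of averages in the choice of the stopping cubes. -/
def stopRatio (n : ℕ) : ℝ≥0∞ := 2 * 3 ^ n

/-- The dyadic cubes on which the average of `w` reaches a level of magnitude (a power of
`stopRatio n`) for the first time, coming from the larger cubes. -/
def stoppingCubes (w : EuclideanSpace ℝ (Fin n) → ℝ≥0∞) : Set (DyadicIndex n) :=
  {P | ∃ k : ℤ, dyadicAvg w P ∈ Ioc (stopRatio n ^ k) (stopRatio n ^ (k + 1)) ∧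
    ∀ R, Sub P R → R ≠ P → dyadicAvg w R ≤ stopRatio n ^ k}

/-- The part of a dyadic cube that is not covered by subcubes with much larger averages. -/
def majorPart (w : EuclideanSpace ℝ (Fin n) → ℝ≥0∞) (P : DyadicIndex n) :
    Set (EuclideanSpace ℝ (Fin n)) :=
  dcube P \ ⋃ R ∈ {R | Sub R P ∧ stopRatio n * dyadicAvg w P < dyadicAvg w R}, dcube R

theorem one_lt_stopRatio (n : ℕ) : 1 < stopRatio n :=
  ENNReal.one_lt_two.trans_le (le_mul_of_one_le_right zero_le (one_le_pow₀ (by norm_num)))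

theorem stopRatio_ne_zero (n : ℕ) : stopRatio n ≠ 0 := (one_pos.trans (one_lt_stopRatio n)).ne'

theorem stopRatio_ne_top (n : ℕ) : stopRatio n ≠ ∞ := by unfold stopRatio; finiteness

theorem lt_of_stopRatio_zpow_lt {k j : ℤ} (h : stopRatio n ^ k < stopRatio n ^ j) : k < j := by
  by_contra! h'
  exact absurd h (not_lt.2 (ENNReal.zpow_le_of_le (one_lt_stopRatio n).le h'))

theorem dyadicAvg_mul_volume (w : EuclideanSpace ℝ (Fin n) → ℝ≥0∞) (Q : DyadicIndex n) :
    dyadicAvg w Q * volume (dcube Q) = ∫⁻ x in dcube Q, w x :=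
  ENNReal.div_mul_cancel (volume_dcube_ne_zero Q) (volume_dcube_ne_top Q)

theorem dyadicAvg_ne_top {w : EuclideanSpace ℝ (Fin n) → ℝ≥0∞} (hw : ∫⁻ x, w x ≠ ∞)
    (Q : DyadicIndex n) : dyadicAvg w Q ≠ ∞ :=
  ENNReal.div_ne_top ((setLIntegral_le_lintegral (dcube Q) w).trans_lt
    hw.lt_top).ne (volume_dcube_ne_zero Q)

/-- With `stopRatio n ^ k` the power just below the average over `Q`, take the maximal `P ⊇ Q` whose
average exceeds it; finite mass bounds the level of such cubes. The magnitude `j` of `P` may exceed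
`k`, but larger cubes have averages at most `stopRatio n ^ k ≤ stopRatio n ^ j`, so `P` is stopping.
-/
theorem exists_stoppingCube (hn : n ≠ 0) {w : EuclideanSpace ℝ (Fin n) → ℝ≥0∞}
    (hw : ∫⁻ x, w x ≠ ∞) {Q : DyadicIndex n} (hQ : dyadicAvg w Q ≠ 0) :
    ∃ P ∈ stoppingCubes w, Sub Q P ∧ dyadicAvg w Q ≤ stopRatio n * dyadicAvg w P := by
  have h1 := one_lt_stopRatio n
  have h0 := stopRatio_ne_zero n
  have ht := stopRatio_ne_top n
  obtain ⟨k, hk, hk'⟩ := ENNReal.exists_mem_Ioc_zpow hQ (dyadicAvg_ne_top hw Q) h1 ht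
  have hk0 : stopRatio n ^ k ≠ 0 := (ENNReal.zpow_pos h0 ht k).ne'
  have hkt : stopRatio n ^ k ≠ ∞ := ENNReal.zpow_ne_top h0 ht k
  obtain ⟨K, hK⟩ := level_le_of_volume_le (n := n) hn (c := (∫⁻ x, w x) / stopRatio n ^ k)
    (ENNReal.div_ne_top hw hk0)
  obtain ⟨P, hP, hQP, hmax⟩ := exists_maximal_of_level_le
    (S := {R : DyadicIndex n | stopRatio n ^ k < dyadicAvg w R}) (K := K)
    (fun R hR => hK R (by
      rw [ENNReal.le_div_iff_mul_le (Or.inl hk0) (Or.inl hkt), mul_comm]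
      refine (mul_le_mul_left (le_of_lt hR) _).trans ?_
      rw [dyadicAvg_mul_volume]
      exact setLIntegral_le_lintegral _ _)) ⟨Q, hk, Sub.refl Q⟩
  have hP : stopRatio n ^ k < dyadicAvg w P := hP
  obtain ⟨j, hj, hj'⟩ := ENNReal.exists_mem_Ioc_zpow (zero_le.trans_lt hP).ne'
    (dyadicAvg_ne_top hw P) h1 ht
  have hkj : k ≤ j := Int.lt_add_one_iff.1 (lt_of_stopRatio_zpow_lt (hP.trans_le hj'))
  refine ⟨P, ⟨j, ⟨hj, hj'⟩, fun R hPR hne => ?_⟩, hQP, ?_⟩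
  · refine le_trans ?_ (ENNReal.zpow_le_of_le h1.le hkj)
    by_contra! hlt
    exact hne (hmax R hlt hPR)
  · refine hk'.trans ?_
    rw [ENNReal.zpow_add h0 ht, zpow_one, mul_comm]
    gcongr

theorem measurableSet_majorPart (w : EuclideanSpace ℝ (Fin n) → ℝ≥0∞) (P : DyadicIndex n) :
    MeasurableSet (majorPart w P) :=
  (measurableSet_dcube P).diff
    (MeasurableSet.biUnion (to_countable _) fun R _ => measurableSet_dcube R)

/-- The weak type estimate for `w` restricted to `P`, at height `2 * 3 ^ n` times its average,
bounds the removed volume by half of that of `P`. This fixes the value of `stopRatio`. -/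
theorem volume_le_two_mul_majorPart (hn : n ≠ 0) {w : EuclideanSpace ℝ (Fin n) → ℝ≥0∞}
    (hw : ∫⁻ x, w x ≠ ∞) {P : DyadicIndex n} (hP : dyadicAvg w P ≠ 0) :
    volume (dcube P) ≤ 2 * volume (majorPart w P) := by
  have h0 := stopRatio_ne_zero n
  have ht := stopRatio_ne_top n
  have hPt := dyadicAvg_ne_top hw P
  set S : Set (DyadicIndex n) := {R | Sub R P ∧ stopRatio n * dyadicAvg w P < dyadicAvg w R}
    with hS
  have hbad : volume (⋃ R ∈ S, dcube R) ≤ 2⁻¹ * volume (dcube P) := by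
    calc volume (⋃ R ∈ S, dcube R) ≤ volume (⋃ R ∈ S, tcube R) :=
          measure_mono (iUnion₂_mono fun R _ => dcube_subset_tcube R)
      _ ≤ 3 ^ n * ((stopRatio n * dyadicAvg w P)⁻¹ * ∫⁻ x, (dcube P).indicator w x) := by
          refine volume_biUnion_tcube_le hn _ (mul_ne_zero h0 hP) (ENNReal.mul_ne_top ht hPt)
            fun R hR => ?_
          rw [setLIntegral_indicator (measurableSet_dcube P),
            inter_eq_self_of_subset_right hR.1.dcube_subset, ← dyadicAvg_mul_volume]
          exact mul_le_mul_left hR.2.le _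
      _ = 2⁻¹ * volume (dcube P) := by
          rw [lintegral_indicator (measurableSet_dcube P), ← dyadicAvg_mul_volume,
            ENNReal.mul_inv (Or.inl h0) (Or.inl ht), mul_assoc,
            ENNReal.inv_mul_cancel_left hP hPt, stopRatio,
            ENNReal.mul_inv (Or.inl (by simp)) (Or.inl (by simp)), ← mul_assoc, mul_left_comm,
            ENNReal.mul_inv_cancel (by simp) (by simp), mul_one]
  have h1 : volume (dcube P) ≤ volume (majorPart w P) + 2⁻¹ * volume (dcube P) :=
    (measure_le_inter_add_sdiff _ _ (⋃ R ∈ S, dcube R)).trans (by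
      rw [add_comm]
      gcongr
      · exact le_rfl
      · exact (measure_mono inter_subset_right).trans hbad)
  have h2 : volume (dcube P) = 2⁻¹ * volume (dcube P) + 2⁻¹ * volume (dcube P) := by
    rw [← add_mul, ENNReal.inv_two_add_inv_two, one_mul]
  have hfin : 2⁻¹ * volume (dcube P) ≠ ∞ :=
    ENNReal.mul_ne_top (by simp) (volume_dcube_ne_top P)
  have h3 : 2⁻¹ * volume (dcube P) ≤ volume (majorPart w P) := by
    rw [h2] at h1
    refine (ENNReal.add_le_add_iff_right hfin).1 (h1.trans (le_of_eq ?_))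
    rw [← h2]
  rwa [← ENNReal.div_eq_inv_mul, ENNReal.div_le_iff' (by simp) (by simp)] at h3

/-- If `x` is in the major parts of two stopping cubes, these are nested. The smaller one has the
larger magnitude by the stopping rule, yet its average is at most `stopRatio n` times that of the
larger one, as it was not removed. So the magnitudes differ by exactly one, and at most one cube of
each parity is possible. -/
theorem tsum_indicator_majorPart_le (w : EuclideanSpace ℝ (Fin n) → ℝ≥0∞)
    (x : EuclideanSpace ℝ (Fin n)) :
    ∑' P : stoppingCubes w,
      (majorPart w P.1).indicator (1 : EuclideanSpace ℝ (Fin n) → ℝ≥0∞) x ≤ 2 := by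
  have h0 := stopRatio_ne_zero n
  have ht := stopRatio_ne_top n
  choose k hk hk' using fun P : stoppingCubes w => P.2
  set T : Set (stoppingCubes w) := {P | x ∈ majorPart w P.1} with hT
  have key : ∀ P ∈ T, ∀ R ∈ T, Sub P.1 R.1 → P ≠ R → k P = k R + 1 := by
    intro P hP R hR hPR hne
    have h1 : k R < k P := lt_of_stopRatio_zpow_lt
      ((hk R).1.trans_le (hk' P R.1 hPR fun h => hne (Subtype.ext h).symm))
    have h2 : dyadicAvg w P.1 ≤ stopRatio n * dyadicAvg w R.1 := by
      by_contra! h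
      exact hR.2 (mem_iUnion₂.2 ⟨P.1, ⟨hPR, h⟩, hP.1⟩)
    have h3 : stopRatio n ^ k P < stopRatio n ^ (k R + 2) := by
      refine (hk P).1.trans_le (h2.trans ?_)
      rw [show k R + 2 = (k R + 1) + 1 by ring, ENNReal.zpow_add h0 ht (k R + 1), zpow_one, mul_comm]
      exact mul_le_mul_left (hk R).2 _
    have := lt_of_stopRatio_zpow_lt h3
    omega
  have hinj : InjOn (fun P => decide (Even (k P))) T := by
    intro P hP R hR hpar
    by_contra hne
    have hpar : Even (k P) ↔ Even (k R) := by simpa using hpar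
    rcases le_total P.1.1 R.1.1 with h | h
    · have := key P hP R hR (sub_of_mem hP.1 hR.1 h) hne
      rw [this, Int.even_add_one] at hpar
      tauto
    · have := key R hR P hP (sub_of_mem hR.1 hP.1 h) (Ne.symm hne)
      rw [this, Int.even_add_one] at hpar
      tauto
  calc ∑' P : stoppingCubes w,
        (majorPart w P.1).indicator (1 : EuclideanSpace ℝ (Fin n) → ℝ≥0∞) x
      = ∑' P : stoppingCubes w, T.indicator (fun _ => (1 : ℝ≥0∞)) P := rfl
    _ = T.encard := by rw [← tsum_subtype, ENNReal.tsum_set_one]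
    _ ≤ ((univ : Set Bool).encard : ℝ≥0∞) := by
        exact_mod_cast encard_le_encard_of_injOn (mapsTo_univ _ _) hinj
    _ ≤ 2 := by
        rw [encard_univ]
        simp

/-- The Carleson embedding for the stopping cubes. -/
theorem tsum_stoppingCubes_le (hn : n ≠ 0) {w : EuclideanSpace ℝ (Fin n) → ℝ≥0∞}
    (hw : ∫⁻ x, w x ≠ ∞) (c : DyadicIndex n → ℝ≥0∞) {p : ℝ} (hp : 0 ≤ p) :
    ∑' P : stoppingCubes w, volume (dcube P.1) * c P.1 ^ p ≤ 4 * ∫⁻ x, dyadicSup c x ^ p := by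
  have hpos : ∀ P : stoppingCubes w, dyadicAvg w P.1 ≠ 0 := by
    rintro ⟨P, k, hk, -⟩
    exact (zero_le.trans_lt hk.1).ne'
  calc ∑' P : stoppingCubes w, volume (dcube P.1) * c P.1 ^ p
      ≤ ∑' P : stoppingCubes w, 2 * ∫⁻ x, c P.1 ^ p *
          (majorPart w P.1).indicator (1 : EuclideanSpace ℝ (Fin n) → ℝ≥0∞) x := by
        refine ENNReal.tsum_le_tsum fun P => ?_
        -- One factor two comes from replacing `P` by its major part, the other from the overlap of
        -- the major parts; hence the constant four.
        rw [lintegral_const_mul _ (measurable_one.indicator (measurableSet_majorPart w _)),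
          lintegral_indicator_one (measurableSet_majorPart w _), mul_left_comm, mul_comm]
        gcongr
        exact volume_le_two_mul_majorPart hn hw (hpos P)
    _ = 2 * ∫⁻ x, ∑' P : stoppingCubes w, c P.1 ^ p *
          (majorPart w P.1).indicator (1 : EuclideanSpace ℝ (Fin n) → ℝ≥0∞) x := by
        rw [ENNReal.tsum_mul_left, lintegral_tsum]
        exact fun P => (measurable_const.mul
          (measurable_one.indicator (measurableSet_majorPart w P.1))).aemeasurable
    _ ≤ 2 * ∫⁻ x, dyadicSup c x ^ p * 2 := by
        gcongr with x
        refine le_trans (ENNReal.tsum_le_tsum (g := fun P : stoppingCubes w => dyadicSup c x ^ p *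
          (majorPart w P.1).indicator (1 : EuclideanSpace ℝ (Fin n) → ℝ≥0∞) x) fun P => ?_) ?_
        · by_cases hx : x ∈ majorPart w P.1
          · gcongr
            exact le_dyadicSup c hx.1
          · simp [indicator_of_notMem hx]
        · rw [ENNReal.tsum_mul_left]
          gcongr
          exact tsum_indicator_majorPart_le w x
    _ = 4 * ∫⁻ x, dyadicSup c x ^ p := by
        rw [lintegral_mul_const' _ _ (by simp), mul_comm (∫⁻ _, _), ← mul_assoc]
        norm_num

/-! ### Dyadic discretization of the kernel -/

/-- One term suffices: if `2^k ≤ |x - y| < 2^(k+1)`, the cube of level `k + 1` containing `x` has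
`y` in its triple, and its side is at most `2 |x - y|`. -/
theorem ofReal_kernel_le {α : ℝ} (hαn : α < n) (x y : EuclideanSpace ℝ (Fin n)) :
    ENNReal.ofReal ((‖x - y‖ ^ ((n : ℝ) - α))⁻¹) ≤
      ENNReal.ofReal (2 ^ ((n : ℝ) - α)) * ∑' Q : DyadicIndex n,
        ENNReal.ofReal (side Q ^ (α - n)) * ((dcube Q).indicator 1 x * (tcube Q).indicator 1 y) := by
  have hpos : 0 < (n : ℝ) - α := sub_pos.2 hαn
  rcases eq_or_ne x y with rfl | hxy
  -- On the diagonal the kernel is `0⁻¹ = 0`.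
  · simp [Real.zero_rpow hpos.ne']
  have hd : 0 < ‖x - y‖ := norm_pos_iff.2 (sub_ne_zero.2 hxy)
  obtain ⟨k, hk, hk'⟩ := exists_mem_Ico_zpow hd one_lt_two
  set Q := dyadicAt (k + 1) x with hQ
  have hside : side Q = 2 ^ (k + 1) := rfl
  have hx : x ∈ dcube Q := mem_dcube_dyadicAt _ _
  have hy : y ∈ tcube Q := by
    rw [mem_tcube]
    rw [mem_dcube] at hx
    intro i
    obtain ⟨h1, h2⟩ := hx i
    have h3 : |x i - y i| < side Q := by
      rw [hside]
      refine lt_of_le_of_lt ?_ hk'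
      simpa using PiLp.norm_apply_le (x - y) i
    rw [abs_lt] at h3
    constructor <;> nlinarith
  refine le_trans ?_ (mul_le_mul_right (ENNReal.le_tsum Q) _)
  rw [indicator_of_mem hx, indicator_of_mem hy, Pi.one_apply, Pi.one_apply, mul_one, mul_one,
    ← ENNReal.ofReal_mul (by positivity)]
  refine ENNReal.ofReal_le_ofReal ?_
  have h4 : (‖x - y‖ ^ ((n : ℝ) - α))⁻¹ ≤ (((2 : ℝ) ^ k) ^ ((n : ℝ) - α))⁻¹ := by gcongr
  refine h4.trans (le_of_eq ?_)
  rw [hside, zpow_add_one₀ two_ne_zero, show α - n = -((n : ℝ) - α) by ring,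
    Real.rpow_neg (by positivity), Real.mul_rpow (by positivity) (by positivity)]
  field_simp

theorem lintegral_lintegral_kernel_le {α : ℝ} (hαn : α < n)
    {φ w : EuclideanSpace ℝ (Fin n) → ℝ≥0∞} (hφ : Measurable φ) (hw : Measurable w) :
    ∫⁻ x, (∫⁻ y, ENNReal.ofReal ((‖x - y‖ ^ ((n : ℝ) - α))⁻¹) * φ y) * w x ≤
      ENNReal.ofReal (2 ^ ((n : ℝ) - α)) * ∑' Q : DyadicIndex n,
        ENNReal.ofReal (side Q ^ α) * (∫⁻ y in tcube Q, φ y) * dyadicAvg w Q := by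
  have hinner : ∀ x, ∫⁻ y, ENNReal.ofReal ((‖x - y‖ ^ ((n : ℝ) - α))⁻¹) * φ y ≤
      ENNReal.ofReal (2 ^ ((n : ℝ) - α)) * ∑' Q : DyadicIndex n,
        ENNReal.ofReal (side Q ^ (α - n)) * (∫⁻ y in tcube Q, φ y) * (dcube Q).indicator 1 x := by
    intro x
    calc ∫⁻ y, ENNReal.ofReal ((‖x - y‖ ^ ((n : ℝ) - α))⁻¹) * φ y
        ≤ ∫⁻ y, ENNReal.ofReal (2 ^ ((n : ℝ) - α)) * ∑' Q : DyadicIndex n,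
            (ENNReal.ofReal (side Q ^ (α - n)) * (dcube Q).indicator 1 x) *
              (tcube Q).indicator φ y := by
          refine lintegral_mono fun y => ?_
          refine (mul_le_mul_left (ofReal_kernel_le hαn x y) _).trans (le_of_eq ?_)
          rw [mul_assoc, ← ENNReal.tsum_mul_right]
          congr 2
          ext Q
          rw [mul_assoc, mul_assoc, mul_assoc]
          congr 2
          by_cases hy : y ∈ tcube Q <;> simp [hy]
      _ = _ := by
          rw [lintegral_const_mul' _ _ ENNReal.ofReal_ne_top, lintegral_tsum]
          · congr 2
            ext Q
            rw [lintegral_const_mul _ (hφ.indicator (measurableSet_tcube Q)),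
              lintegral_indicator (measurableSet_tcube Q)]
            ring
          · exact fun Q => ((hφ.indicator (measurableSet_tcube Q)).const_mul _).aemeasurable
  calc ∫⁻ x, (∫⁻ y, ENNReal.ofReal ((‖x - y‖ ^ ((n : ℝ) - α))⁻¹) * φ y) * w x
      ≤ ∫⁻ x, ENNReal.ofReal (2 ^ ((n : ℝ) - α)) * ∑' Q : DyadicIndex n,
          ENNReal.ofReal (side Q ^ (α - n)) * (∫⁻ y in tcube Q, φ y) *
            (dcube Q).indicator w x := by
        refine lintegral_mono fun x => ?_
        refine (mul_le_mul_left (hinner x) _).trans (le_of_eq ?_)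
        rw [mul_assoc, ← ENNReal.tsum_mul_right]
        congr 2
        ext Q
        rw [mul_assoc]
        congr 1
        by_cases hx : x ∈ dcube Q <;> simp [hx]
    _ = _ := by
        rw [lintegral_const_mul' _ _ ENNReal.ofReal_ne_top, lintegral_tsum]
        · congr 2
          ext Q
          rw [lintegral_const_mul _ (hw.indicator (measurableSet_dcube Q)),
            lintegral_indicator (measurableSet_dcube Q), ← dyadicAvg_mul_volume, volume_dcube,
            Real.rpow_sub (side_pos Q), Real.rpow_natCast,
            ENNReal.ofReal_div_of_pos (pow_pos (side_pos Q) n),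
            ENNReal.ofReal_pow (side_pos Q).le, mul_comm (dyadicAvg w Q), mul_mul_mul_comm,
            ENNReal.div_mul_cancel, mul_assoc]
          · exact pow_ne_zero _ (by simpa using side_pos Q)
          · exact ENNReal.pow_ne_top ENNReal.ofReal_ne_top
        · exact fun Q => ((hw.indicator (measurableSet_dcube Q)).const_mul _).aemeasurable

/-- At `j` levels below `P` the triples lie in the triple of `P` and overlap at most `3 ^ n` times,
while `side ^ α` has dropped by `2^(-αj)`; the series over `j` converges since `α > 0`. -/
theorem tsum_sub_le {α : ℝ} (hα : 0 < α) :
    ∃ C : ℝ≥0, ∀ φ : EuclideanSpace ℝ (Fin n) → ℝ≥0∞, Measurable φ → ∀ P : DyadicIndex n,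
      ∑' Q : DyadicIndex n, {Q | Sub Q P}.indicator
        (fun Q => ENNReal.ofReal (side Q ^ α) * ∫⁻ y in tcube Q, φ y) Q ≤
      C * (ENNReal.ofReal (side P ^ α) * ∫⁻ y in tcube P, φ y) := by
  set r : ℝ≥0∞ := ENNReal.ofReal (2 ^ (-α)) with hr
  have hr1 : r < 1 := by
    rw [hr, ENNReal.ofReal_lt_one]
    exact Real.rpow_lt_one_of_one_lt_of_neg one_lt_two (neg_lt_zero.2 hα)
  have hC : (1 - r)⁻¹ * 3 ^ n ≠ ∞ :=
    ENNReal.mul_ne_top (ENNReal.inv_ne_top.2 (tsub_pos_of_lt hr1).ne') (by finiteness)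
  refine ⟨((1 - r)⁻¹ * 3 ^ n).toNNReal, fun φ hφ P => ?_⟩
  rw [ENNReal.coe_toNNReal hC]
  set X := ∫⁻ y in tcube P, φ y with hX
  have hlevel : ∀ k : ℤ, ∑' m : Fin n → ℤ, {Q | Sub Q P}.indicator
        (fun Q => ENNReal.ofReal (side Q ^ α) * ∫⁻ y in tcube Q, φ y) (k, m) ≤
      (Iic P.1).indicator (fun k : ℤ => ENNReal.ofReal (((2 : ℝ) ^ k) ^ α) * (3 ^ n * X)) k := by
    intro k
    by_cases hk : k ≤ P.1
    · rw [indicator_of_mem (mem_Iic.2 hk)]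
      calc ∑' m : Fin n → ℤ, {Q | Sub Q P}.indicator
            (fun Q => ENNReal.ofReal (side Q ^ α) * ∫⁻ y in tcube Q, φ y) (k, m)
          ≤ ∑' m : Fin n → ℤ, ENNReal.ofReal (((2 : ℝ) ^ k) ^ α) *
              ∫⁻ y in tcube P, (tcube (k, m)).indicator 1 y * φ y := by
            refine ENNReal.tsum_le_tsum fun m => ?_
            by_cases hm : Sub (k, m) P
            · rw [indicator_of_mem (show (k, m) ∈ {Q | Sub Q P} from hm)]
              refine mul_le_mul_right (le_of_eq ?_) _
              have : ∀ y, (tcube (k, m)).indicator 1 y * φ y = (tcube (k, m)).indicator φ y := by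
                intro y
                by_cases hy : y ∈ tcube (k, m) <;> simp [hy]
              simp_rw [this]
              rw [setLIntegral_indicator (measurableSet_tcube _),
                inter_eq_self_of_subset_left hm.tcube_subset]
            · rw [indicator_of_notMem (show (k, m) ∉ {Q | Sub Q P} from hm)]
              exact zero_le
        _ = ENNReal.ofReal (((2 : ℝ) ^ k) ^ α) *
              ∫⁻ y in tcube P, (∑' m : Fin n → ℤ, (tcube (k, m)).indicator 1 y) * φ y := by
            rw [ENNReal.tsum_mul_left, ← lintegral_tsum]
            · simp_rw [ENNReal.tsum_mul_right]
            · exact fun m => ((measurable_one.indicator (measurableSet_tcube _)).mul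
                hφ).aemeasurable
        _ ≤ ENNReal.ofReal (((2 : ℝ) ^ k) ^ α) * ∫⁻ y in tcube P, 3 ^ n * φ y := by
            gcongr with y
            exact tsum_indicator_tcube_le k y
        _ = _ := by rw [lintegral_const_mul' _ _ (by finiteness)]
    · rw [indicator_of_notMem (by simpa using hk)]
      refine le_of_eq (ENNReal.tsum_eq_zero.2 fun m => indicator_of_notMem ?_ _)
      exact fun h => hk h.1
  have hinj : Function.Injective fun j : ℕ => P.1 - (j : ℤ) := fun a b h => by
    simpa using h
  calc ∑' Q : DyadicIndex n, {Q | Sub Q P}.indicator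
        (fun Q => ENNReal.ofReal (side Q ^ α) * ∫⁻ y in tcube Q, φ y) Q
      = ∑' (k : ℤ) (m : Fin n → ℤ), {Q | Sub Q P}.indicator
        (fun Q => ENNReal.ofReal (side Q ^ α) * ∫⁻ y in tcube Q, φ y) (k, m) :=
        ENNReal.tsum_prod (f := fun k m => {Q | Sub Q P}.indicator
        (fun Q => ENNReal.ofReal (side Q ^ α) * ∫⁻ y in tcube Q, φ y) (k, m))
    _ ≤ ∑' k : ℤ, (Iic P.1).indicator
          (fun k : ℤ => ENNReal.ofReal (((2 : ℝ) ^ k) ^ α) * (3 ^ n * X)) k :=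
        ENNReal.tsum_le_tsum hlevel
    _ = ∑' j : ℕ, (Iic P.1).indicator
          (fun k : ℤ => ENNReal.ofReal (((2 : ℝ) ^ k) ^ α) * (3 ^ n * X)) (P.1 - j) := by
        refine (hinj.tsum_eq fun k hk => ?_).symm
        have hk : k ≤ P.1 := by
          by_contra h
          exact hk (indicator_of_notMem (by simpa using h) _)
        obtain ⟨j, hj⟩ := Int.eq_ofNat_of_zero_le (sub_nonneg.2 hk)
        exact ⟨j, by dsimp only; omega⟩
    _ = ∑' j : ℕ, r ^ j * (ENNReal.ofReal (side P ^ α) * (3 ^ n * X)) := by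
        congr 1
        ext j
        rw [indicator_of_mem (by simp), ← mul_assoc (r ^ j), hr, ← ENNReal.ofReal_pow (by positivity),
          ← ENNReal.ofReal_mul (by positivity), side, ← Real.rpow_intCast, ← Real.rpow_intCast,
          ← Real.rpow_natCast, ← Real.rpow_mul (by positivity), ← Real.rpow_mul (by positivity),
          ← Real.rpow_mul (by positivity), ← Real.rpow_add (by positivity)]
        congr 4
        push_cast
        ring
    _ = _ := by
        rw [ENNReal.tsum_mul_right, ENNReal.tsum_geometric]
        ring

/-! ### The bilinear estimate -/

/-- Hölder's inequality for series, with exponents `p` and `r ≤ p'`. -/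
theorem tsum_mul_le_of_conjExponent_le {ι : Type*} (a b : ι → ℝ≥0∞) {p p' r : ℝ}
    (hp : p.HolderConjugate p') (hr : 0 < r) (hrp : r ≤ p') :
    ∑' i, a i * b i ≤ (∑' i, a i ^ p) ^ (1 / p) * (∑' i, b i ^ r) ^ (1 / r) := by
  let _ : MeasurableSpace ι := ⊤
  have h1 : ∑' i, a i * b i ≤ (∑' i, a i ^ p) ^ (1 / p) * (∑' i, b i ^ p') ^ (1 / p') := by
    have h := ENNReal.lintegral_mul_le_Lp_mul_Lq Measure.count hp
      (Measurable.of_discrete (f := a)).aemeasurable (Measurable.of_discrete (f := b)).aemeasurable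
    simpa [lintegral_count' Measurable.of_discrete] using h
  refine h1.trans (mul_le_mul_right ?_ _)
  have hp' : 0 < p' := hp.symm.pos
  set S := ∑' i, b i ^ r with hS
  -- Each term is at most the `ℓ^r` norm, which gives `ℓ^r ⊆ ℓ^(p')` with constant one.
  have hb : ∀ i, b i ≤ S ^ (1 / r) := fun i => by
    rw [one_div, ENNReal.le_rpow_inv_iff hr]
    exact ENNReal.le_tsum i
  calc (∑' i, b i ^ p') ^ (1 / p') ≤ (∑' i, b i ^ r * (S ^ (1 / r)) ^ (p' - r)) ^ (1 / p') := by
        gcongr with i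
        rw [show b i ^ p' = b i ^ r * b i ^ (p' - r) by
          rw [← ENNReal.rpow_add_of_nonneg _ _ hr.le (sub_nonneg.2 hrp), add_sub_cancel]]
        exact mul_le_mul_right (ENNReal.rpow_le_rpow (hb i) (sub_nonneg.2 hrp)) _
    _ = ((S ^ (1 / r)) ^ r * (S ^ (1 / r)) ^ (p' - r)) ^ (1 / p') := by
        rw [ENNReal.tsum_mul_right, one_div r, ENNReal.rpow_inv_rpow hr.ne']
    _ = S ^ (1 / r) := by
        rw [← ENNReal.rpow_add_of_nonneg _ _ hr.le (sub_nonneg.2 hrp), add_sub_cancel, one_div p',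
          ENNReal.rpow_rpow_inv hp'.ne']

theorem le_bumpConst (α p q : ℝ) (A B : ℝ → ℝ) (u σ : EuclideanSpace ℝ (Fin n) → ℝ)
    (P : DyadicIndex n) :
    volume (tcube P) ^ (α / n + 1 / q - 1 / p)
      * luxNorm A (tcube P) (fun x => u x ^ (1 / q))
      * luxNorm B (tcube P) (fun x => σ x ^ (1 / p.conjExponent)) ≤ bumpConst α p q A B u σ :=
  le_iSup₂_of_le _ (3 * side P) (le_iSup_of_le (mul_pos three_pos (side_pos P)) le_rfl)

theorem rpow_inv_mul_rpow_inv {p p' : ℝ} (hp : p.HolderConjugate p') {x : ℝ} (hx : 0 ≤ x) :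
    x ^ (1 / p) * x ^ (1 / p') = x := by
  have h1 := hp.pos
  have h2 := hp.symm.pos
  rw [← Real.rpow_add_of_nonneg hx (by positivity) (by positivity), one_div, one_div,
    hp.inv_add_inv_eq_one, Real.rpow_one]

theorem lintegral_mul_weight_le {B : ℝ → ℝ} (hB : IsYoung B) {p p' : ℝ}
    (hp : p.HolderConjugate p') {f σ : EuclideanSpace ℝ (Fin n) → ℝ} (hf : Measurable f)
    (hf0 : ∀ x, 0 ≤ f x) (hσ : Measurable σ) (hσ0 : ∀ x, 0 ≤ σ x) (P : DyadicIndex n) :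
    ∫⁻ x in tcube P, ENNReal.ofReal (f x * σ x) ≤ 2 * volume (tcube P) *
      (luxNorm B (tcube P) (fun x => σ x ^ (1 / p')) *
        luxNorm (associate B) (tcube P) (fun x => f x * σ x ^ (1 / p))) := by
  refine le_trans (le_of_eq ?_) (lintegral_mul_le_luxNorm hB.associate_mono.measurable
    (fun s t hs _ => hB.mul_le_add_associate hs) (volume_tcube_ne_zero P) (volume_tcube_ne_top P)
    (by fun_prop) (by fun_prop))
  refine lintegral_congr fun x => ?_
  have h1 := Real.rpow_nonneg (hσ0 x) (1 / p)
  have h2 := Real.rpow_nonneg (hσ0 x) (1 / p')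
  rw [abs_of_nonneg h2, abs_of_nonneg (mul_nonneg (hf0 x) h1), mul_left_comm, mul_comm (σ x ^ _),
    rpow_inv_mul_rpow_inv hp (hσ0 x)]

/-- Orlicz Hölder is applied to both integrals on the triple of `P`. Enlarging the integral of `g u`
from `P` to its triple costs `3 ^ n` and lets both bump norms be taken over the same cube, as the
bump constant demands. -/
theorem bump_term_le (hn : n ≠ 0) {α p q : ℝ} (hα : 0 < α) (hp : 1 < p) (hq : 1 < q)
    {A B : ℝ → ℝ} (hA : IsYoung A) (hB : IsYoung B) {u σ f g : EuclideanSpace ℝ (Fin n) → ℝ}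
    (hu : Measurable u) (hu0 : ∀ x, 0 ≤ u x) (hσ : Measurable σ) (hσ0 : ∀ x, 0 ≤ σ x)
    (hf : Measurable f) (hf0 : ∀ x, 0 ≤ f x) (hg : Measurable g) (hg0 : ∀ x, 0 ≤ g x)
    (P : DyadicIndex n) :
    ENNReal.ofReal (side P ^ α) * (∫⁻ x in tcube P, ENNReal.ofReal (f x * σ x)) *
        dyadicAvg (fun x => ENNReal.ofReal (g x * u x)) P ≤
      4 * 3 ^ n * (3 ^ n) ^ (1 / p + 1 / q.conjExponent) * bumpConst α p q A B u σ *
        ((volume (dcube P) ^ (1 / p) *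
          luxNorm (associate B) (tcube P) (fun x => f x * σ x ^ (1 / p))) *
        (volume (dcube P) ^ (1 / q.conjExponent) *
          luxNorm (associate A) (tcube P) (fun x => g x * u x ^ (1 / q.conjExponent)))) := by
  have hpc := Real.HolderConjugate.conjExponent hp
  have hqc := Real.HolderConjugate.conjExponent hq
  set p' := p.conjExponent
  set q' := q.conjExponent
  have hp0 := hpc.pos
  have hq0 := hqc.symm.pos
  set a := luxNorm (associate B) (tcube P) (fun x => f x * σ x ^ (1 / p))
  set b := luxNorm (associate A) (tcube P) (fun x => g x * u x ^ (1 / q'))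
  set LA := luxNorm A (tcube P) (fun x => u x ^ (1 / q))
  set LB := luxNorm B (tcube P) (fun x => σ x ^ (1 / p'))
  set v := volume (dcube P)
  set V := volume (tcube P)
  have hV : V = 3 ^ n * v := volume_tcube P
  have hV0 : V ≠ 0 := volume_tcube_ne_zero P
  have hVt : V ≠ ∞ := volume_tcube_ne_top P
  have h1 : ∫⁻ x in tcube P, ENNReal.ofReal (f x * σ x) ≤ 2 * V * (LB * a) :=
    lintegral_mul_weight_le hB hpc hf hf0 hσ hσ0 P
  have h2 : dyadicAvg (fun x => ENNReal.ofReal (g x * u x)) P ≤ 2 * 3 ^ n * (LA * b) := by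
    have h3 : ∫⁻ x in dcube P, ENNReal.ofReal (g x * u x) ≤ 2 * V * (LA * b) :=
      (lintegral_mono_set (dcube_subset_tcube P)).trans
        (lintegral_mul_weight_le hA hqc.symm hg hg0 hu hu0 P)
    refine ENNReal.div_le_of_le_mul (h3.trans (le_of_eq ?_))
    rw [hV]
    ring
  have h3 : ENNReal.ofReal (side P ^ α) ≤ V ^ (α / n) := by
    have hn' : (n : ℝ) ≠ 0 := Nat.cast_ne_zero.2 hn
    have : ENNReal.ofReal (side P ^ α) = v ^ (α / n) := by
      rw [show v = _ from volume_dcube P, ← ENNReal.rpow_natCast, ← ENNReal.rpow_mul,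
        mul_div_cancel₀ _ hn', ENNReal.ofReal_rpow_of_pos (side_pos P)]
    rw [this]
    exact ENNReal.rpow_le_rpow (measure_mono (dcube_subset_tcube P)) (by positivity)
  -- Since `1 / q + 1 / q' = 1`, the exponent splits as `α/n + 1 = (α/n + 1/q - 1/p) + 1/p + 1/q'`.
  have h4 : V ^ (α / n) * V = V ^ (α / n + 1 / q - 1 / p) *
      ((3 ^ n) ^ (1 / p + 1 / q') * (v ^ (1 / p) * v ^ (1 / q'))) := by
    rw [← ENNReal.rpow_add_of_nonneg _ _ (by positivity) (by positivity),
      ← ENNReal.mul_rpow_of_nonneg _ _ (by positivity), ← hV, ← ENNReal.rpow_add _ _ hV0 hVt]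
    nth_rewrite 2 [← ENNReal.rpow_one V]
    rw [← ENNReal.rpow_add _ _ hV0 hVt]
    congr 1
    have := hqc.inv_add_inv_eq_one
    simp only [one_div]
    linarith
  calc ENNReal.ofReal (side P ^ α) * (∫⁻ x in tcube P, ENNReal.ofReal (f x * σ x)) *
        dyadicAvg (fun x => ENNReal.ofReal (g x * u x)) P
      ≤ V ^ (α / n) * (2 * V * (LB * a)) * (2 * 3 ^ n * (LA * b)) := by gcongr
    _ = 4 * 3 ^ n * (V ^ (α / n) * V) * (LA * LB * (a * b)) := by ring
    _ = 4 * 3 ^ n * (3 ^ n) ^ (1 / p + 1 / q') * (V ^ (α / n + 1 / q - 1 / p) * LA * LB) *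
          ((v ^ (1 / p) * a) * (v ^ (1 / q') * b)) := by
        rw [h4]
        ring
    _ ≤ _ := by
        gcongr
        exact le_bumpConst α p q A B u σ P

/-- Each `Q` is charged to one stopping cube containing it. After interchanging the sums, `hC` sums
everything inside a stopping cube. -/
theorem tsum_le_tsum_stoppingCubes (hn : n ≠ 0) {α : ℝ} {C : ℝ≥0}
    {φ w : EuclideanSpace ℝ (Fin n) → ℝ≥0∞}
    (hC : ∀ P : DyadicIndex n, ∑' Q : DyadicIndex n, {Q | Sub Q P}.indicator
        (fun Q => ENNReal.ofReal (side Q ^ α) * ∫⁻ y in tcube Q, φ y) Q ≤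
      C * (ENNReal.ofReal (side P ^ α) * ∫⁻ y in tcube P, φ y)) (hw : ∫⁻ x, w x ≠ ∞) :
    ∑' Q : DyadicIndex n, ENNReal.ofReal (side Q ^ α) * (∫⁻ y in tcube Q, φ y) * dyadicAvg w Q ≤
      stopRatio n * C * ∑' P : stoppingCubes w,
        ENNReal.ofReal (side P.1 ^ α) * (∫⁻ y in tcube P.1, φ y) * dyadicAvg w P.1 := by
  set G : DyadicIndex n → ℝ≥0∞ := fun Q => ENNReal.ofReal (side Q ^ α) * ∫⁻ y in tcube Q, φ y
    with hG
  calc ∑' Q : DyadicIndex n, G Q * dyadicAvg w Q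
      ≤ ∑' Q : DyadicIndex n, ∑' P : stoppingCubes w,
          stopRatio n * dyadicAvg w P.1 * {Q | Sub Q P.1}.indicator G Q := by
        refine ENNReal.tsum_le_tsum fun Q => ?_
        by_cases hQ : dyadicAvg w Q = 0
        · rw [hQ, mul_zero]
          exact zero_le
        obtain ⟨P, hP, hQP, hle⟩ := exists_stoppingCube hn hw hQ
        refine le_trans ?_ (ENNReal.le_tsum (⟨P, hP⟩ : stoppingCubes w))
        rw [indicator_of_mem (show Q ∈ {Q | Sub Q P} from hQP), mul_comm]
        gcongr
    _ = ∑' P : stoppingCubes w, stopRatio n * dyadicAvg w P.1 *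
          ∑' Q : DyadicIndex n, {Q | Sub Q P.1}.indicator G Q := by
        rw [ENNReal.tsum_comm]
        simp_rw [ENNReal.tsum_mul_left]
    _ ≤ ∑' P : stoppingCubes w, stopRatio n * dyadicAvg w P.1 * (C * G P.1) := by
        gcongr with P
        exact hC P.1
    _ = _ := by
        rw [← ENNReal.tsum_mul_left]
        congr 1
        ext P
        ring

/-- The bilinear form of the conjoined bump theorem. -/
theorem exists_bilinear_le {α p q : ℝ} (hα : 0 < α) (hαn : α < n) (hp : 1 < p)
    (hpq : p ≤ q) {A B : ℝ → ℝ} (hA : IsYoung A) (hB : IsYoung B)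
    (hA' : SatisfiesBp q.conjExponent (associate A)) (hB' : SatisfiesBp p (associate B)) :
    ∃ C : ℝ≥0, ∀ u σ f g : EuclideanSpace ℝ (Fin n) → ℝ, Measurable u → (∀ x, 0 ≤ u x) →
      Measurable σ → (∀ x, 0 ≤ σ x) → Measurable f → (∀ x, 0 ≤ f x) → Measurable g →
      (∀ x, 0 ≤ g x) → ∫⁻ x, ENNReal.ofReal (g x * u x) ≠ ∞ →
      ∫⁻ x, (∫⁻ y, ENNReal.ofReal ((‖x - y‖ ^ ((n : ℝ) - α))⁻¹) * ENNReal.ofReal (f y * σ y)) *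
          ENNReal.ofReal (g x * u x) ≤
        C * bumpConst α p q A B u σ * (∫⁻ x, ENNReal.ofReal (f x ^ p * σ x)) ^ (1 / p) *
          (∫⁻ x, ENNReal.ofReal (g x ^ q.conjExponent * u x)) ^ (1 / q.conjExponent) := by
  have hn : n ≠ 0 := by
    rintro rfl
    simp only [Nat.cast_zero] at hαn
    linarith
  have hq : 1 < q := hp.trans_le hpq
  have hpc := Real.HolderConjugate.conjExponent hp
  have hqc := Real.HolderConjugate.conjExponent hq
  have hp0 := hpc.pos
  have hq0 := hqc.symm.pos
  obtain ⟨C1, hC1⟩ := tsum_sub_le (n := n) hα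
  obtain ⟨sB, hsB0, hsB⟩ := hB.exists_associate_le_half
  obtain ⟨sA, hsA0, hsA⟩ := hA.exists_associate_le_half
  obtain ⟨C2, hC2⟩ := exists_lintegral_orlicz_rpow_le hn hB.associate_mono hB.associate_nonneg
    hsB0 hsB hp0 hB'
  obtain ⟨C3, hC3⟩ := exists_lintegral_orlicz_rpow_le hn hA.associate_mono hA.associate_nonneg
    hsA0 hsA hq0 hA'
  -- This is where `p ≤ q` enters; it allows the second series to carry the exponent `q'` in place
  -- of `p'`.
  have hle : q.conjExponent ≤ p.conjExponent := by
    rw [Real.conjExponent, Real.conjExponent,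
      div_le_div_iff₀ (sub_pos.2 hq) (sub_pos.2 hp)]
    nlinarith
  set p' := p.conjExponent
  set q' := q.conjExponent
  set D : ℝ≥0∞ := ENNReal.ofReal (2 ^ ((n : ℝ) - α)) * (stopRatio n * C1) *
    (4 * 3 ^ n * (3 ^ n) ^ (1 / p + 1 / q')) * ((4 * C2) ^ (1 / p) * (4 * C3) ^ (1 / q')) with hD
  have hDt : D ≠ ∞ := by
    have := stopRatio_ne_top n
    have h1 : 0 ≤ 1 / p + 1 / q' := by positivity
    have h2 : 0 ≤ 1 / p := by positivity
    have h3 : 0 ≤ 1 / q' := by positivity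
    finiteness
  refine ⟨D.toNNReal, fun u σ f g hu hu0 hσ hσ0 hf hf0 hg hg0 hw => ?_⟩
  rw [ENNReal.coe_toNNReal hDt]
  set φ : EuclideanSpace ℝ (Fin n) → ℝ≥0∞ := fun y => ENNReal.ofReal (f y * σ y) with hφ
  set w : EuclideanSpace ℝ (Fin n) → ℝ≥0∞ := fun x => ENNReal.ofReal (g x * u x) with hwdef
  set a : DyadicIndex n → ℝ≥0∞ := fun P =>
    luxNorm (associate B) (tcube P) (fun x => f x * σ x ^ (1 / p)) with ha
  set b : DyadicIndex n → ℝ≥0∞ := fun P =>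
    luxNorm (associate A) (tcube P) (fun x => g x * u x ^ (1 / q')) with hb
  -- Carleson embedding followed by the maximal bound, stated once for use with `(a, f, σ, p)` and
  -- `(b, g, u, q')`.
  have hmax : ∀ (c : DyadicIndex n → ℝ≥0∞) (C : ℝ≥0) (r : ℝ)
      (h v : EuclideanSpace ℝ (Fin n) → ℝ), 0 < r → (∀ x, 0 ≤ h x) → (∀ x, 0 ≤ v x) →
      (∫⁻ x, dyadicSup c x ^ r ≤ C * ∫⁻ x, ENNReal.ofReal (|h x * v x ^ (1 / r)| ^ r)) →
      (∑' P : stoppingCubes w, (volume (dcube P.1) ^ (1 / r) * c P.1) ^ r) ^ (1 / r) ≤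
        (4 * C) ^ (1 / r) * (∫⁻ x, ENNReal.ofReal (h x ^ r * v x)) ^ (1 / r) := by
    intro c C r h v hr hh hv hle
    rw [← ENNReal.mul_rpow_of_nonneg _ _ (by positivity)]
    refine ENNReal.rpow_le_rpow ?_ (by positivity)
    calc ∑' P : stoppingCubes w, (volume (dcube P.1) ^ (1 / r) * c P.1) ^ r
        = ∑' P : stoppingCubes w, volume (dcube P.1) * c P.1 ^ r := by
          congr 1
          ext P
          rw [ENNReal.mul_rpow_of_nonneg _ _ hr.le, one_div, ENNReal.rpow_inv_rpow hr.ne']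
      _ ≤ 4 * (C * ∫⁻ x, ENNReal.ofReal (|h x * v x ^ (1 / r)| ^ r)) :=
          (tsum_stoppingCubes_le hn hw c hr.le).trans (mul_le_mul_right hle _)
      _ = _ := by
          rw [mul_assoc]
          congr 2
          refine lintegral_congr fun x => ?_
          have h1 := Real.rpow_nonneg (hv x) (1 / r)
          rw [abs_of_nonneg (mul_nonneg (hh x) h1), Real.mul_rpow (hh x) h1, one_div,
            Real.rpow_inv_rpow (hv x) hr.ne']
  calc ∫⁻ x, (∫⁻ y, ENNReal.ofReal ((‖x - y‖ ^ ((n : ℝ) - α))⁻¹) * φ y) * w x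
      ≤ ENNReal.ofReal (2 ^ ((n : ℝ) - α)) * ∑' Q : DyadicIndex n,
        ENNReal.ofReal (side Q ^ α) * (∫⁻ y in tcube Q, φ y) * dyadicAvg w Q :=
        lintegral_lintegral_kernel_le hαn (by fun_prop) (by fun_prop)
    _ ≤ ENNReal.ofReal (2 ^ ((n : ℝ) - α)) * (stopRatio n * C1 * ∑' P : stoppingCubes w,
          (4 * 3 ^ n * (3 ^ n) ^ (1 / p + 1 / q') * bumpConst α p q A B u σ) *
          ((volume (dcube P.1) ^ (1 / p) * a P.1) * (volume (dcube P.1) ^ (1 / q') * b P.1))) := by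
        gcongr
        refine (tsum_le_tsum_stoppingCubes hn (hC1 φ (by fun_prop)) hw).trans ?_
        refine mul_le_mul_right (ENNReal.tsum_le_tsum fun P => ?_) _
        exact bump_term_le hn hα hp hq hA hB hu hu0 hσ hσ0 hf hf0 hg hg0 P.1
    _ ≤ ENNReal.ofReal (2 ^ ((n : ℝ) - α)) * (stopRatio n * C1 *
          ((4 * 3 ^ n * (3 ^ n) ^ (1 / p + 1 / q') * bumpConst α p q A B u σ) *
          (((4 * C2) ^ (1 / p) * (∫⁻ x, ENNReal.ofReal (f x ^ p * σ x)) ^ (1 / p)) *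
          ((4 * C3) ^ (1 / q') * (∫⁻ x, ENNReal.ofReal (g x ^ q' * u x)) ^ (1 / q'))))) := by
        rw [ENNReal.tsum_mul_left]
        gcongr
        refine (tsum_mul_le_of_conjExponent_le _ _ hpc hq0 hle).trans ?_
        exact mul_le_mul' (hmax a C2 p f σ hp0 hf0 hσ0 (hC2 _ (by fun_prop)))
          (hmax b C3 q' g u hq0 hg0 hu0 (hC3 _ (by fun_prop)))
    _ = _ := by
        rw [hD]
        ring

/-! ### Duality -/

/-- An `L^q` bound by duality, from bounds on the pairings with the truncations of `T^(q-1)`. -/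
theorem lintegral_rpow_mul_le_of_duality {q q' : ℝ} (hq : q.HolderConjugate q')
    {T : EuclideanSpace ℝ (Fin n) → ℝ≥0∞} (hT : Measurable T)
    {u : EuclideanSpace ℝ (Fin n) → ℝ} (hu : Measurable u) {K : ℝ≥0∞}
    (h : ∀ g : EuclideanSpace ℝ (Fin n) → ℝ, Measurable g → (∀ x, 0 ≤ g x) →
      ∫⁻ x, ENNReal.ofReal (g x * u x) ≠ ∞ →
      ∫⁻ x, T x * ENNReal.ofReal (g x * u x) ≤
        K * (∫⁻ x, ENNReal.ofReal (g x ^ q' * u x)) ^ (1 / q')) :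
    ∫⁻ x, T x ^ q * ENNReal.ofReal (u x) ≤ K ^ q := by
  have hq1 : 0 < q - 1 := hq.sub_one_pos
  -- On a ball where `u` is bounded, truncated powers of `T` are integrable against `u`: the test
  -- function is admissible, and the finite integral `I` can be divided out.
  set S : ℕ → Set (EuclideanSpace ℝ (Fin n)) := fun N => Metric.ball 0 N ∩ {x | u x ≤ N} with hS
  have hSm : ∀ N, MeasurableSet (S N) := fun N =>
    measurableSet_ball.inter (measurableSet_le hu measurable_const)
  have hSmono : Monotone S := fun N N' hN =>
    inter_subset_inter (Metric.ball_subset_ball (by exact_mod_cast hN))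
      fun x (hx : u x ≤ N) => hx.trans (by exact_mod_cast hN)
  have htrunc : ∀ N : ℕ, ∫⁻ x, (S N).indicator
      (fun x => (min (T x) N) ^ q * ENNReal.ofReal (u x)) x ≤ K ^ q := by
    intro N
    have hfin : ∀ x, min (T x) N ≠ ∞ := fun x =>
      ((min_le_right _ _).trans_lt (ENNReal.natCast_lt_top N)).ne
    set I := ∫⁻ x, (S N).indicator (fun x => (min (T x) N) ^ q * ENNReal.ofReal (u x)) x with hI
    have hbound : ∀ r : ℝ, 0 ≤ r → ∫⁻ x, (S N).indicator
        (fun x => (min (T x) N) ^ r * ENNReal.ofReal (u x)) x ≠ ∞ := by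
      intro r hr
      rw [lintegral_indicator (hSm N)]
      refine ne_of_lt (lt_of_le_of_lt (setLIntegral_mono (g := fun _ => (N : ℝ≥0∞) ^ r * N)
        measurable_const fun x hx => ?_) ?_)
      · gcongr
        · exact min_le_right _ _
        · exact (ENNReal.ofReal_le_ofReal hx.2).trans (by simp)
      · rw [setLIntegral_const]
        refine ENNReal.mul_lt_top (by finiteness) ?_
        exact (measure_mono inter_subset_left).trans_lt measure_ball_lt_top
    -- The extremal test function: `(q - 1) q' = q`, so `g ^ q' u` and `min(T, N) g u` have the same
    -- integral `I`.
    set g : EuclideanSpace ℝ (Fin n) → ℝ :=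
      (S N).indicator fun x => (min (T x) N).toReal ^ (q - 1) with hg
    have hgm : Measurable g :=
      ((hT.min measurable_const).ennreal_toReal.pow_const _).indicator (hSm N)
    have hg0 : ∀ x, 0 ≤ g x := fun x =>
      indicator_nonneg (fun x _ => Real.rpow_nonneg ENNReal.toReal_nonneg _) x
    have hgu : ∀ x, ENNReal.ofReal (g x * u x) = (S N).indicator
        (fun x => (min (T x) N) ^ (q - 1) * ENNReal.ofReal (u x)) x := by
      intro x
      by_cases hx : x ∈ S N
      · rw [ENNReal.ofReal_mul (hg0 x), hg, indicator_of_mem hx, indicator_of_mem hx,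
          ← ENNReal.ofReal_rpow_of_nonneg ENNReal.toReal_nonneg hq1.le,
          ENNReal.ofReal_toReal (hfin x)]
      · simp [hg, hx]
    have hgqu : ∀ x, ENNReal.ofReal (g x ^ q' * u x) = (S N).indicator
        (fun x => (min (T x) N) ^ q * ENNReal.ofReal (u x)) x := by
      intro x
      by_cases hx : x ∈ S N
      · rw [ENNReal.ofReal_mul (Real.rpow_nonneg (hg0 x) _), hg, indicator_of_mem hx,
          indicator_of_mem hx, ← Real.rpow_mul ENNReal.toReal_nonneg, hq.sub_one_mul_conj,
          ← ENNReal.ofReal_rpow_of_nonneg ENNReal.toReal_nonneg hq.nonneg,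
          ENNReal.ofReal_toReal (hfin x)]
      · simp [hg, hx, Real.zero_rpow hq.symm.ne_zero]
    have hle : I ≤ K * I ^ (1 / q') := by
      have h1 := h g hgm hg0 (by simp_rw [hgu]; exact hbound _ hq1.le)
      simp_rw [hgqu] at h1
      refine le_trans (lintegral_mono fun x => ?_) h1
      rw [hgu]
      by_cases hx : x ∈ S N
      · rw [indicator_of_mem hx, indicator_of_mem hx, ← mul_assoc]
        gcongr
        calc (min (T x) N) ^ q = (min (T x) N) ^ (1 + (q - 1)) := by ring_nf
          _ = min (T x) N * (min (T x) N) ^ (q - 1) := by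
              rw [ENNReal.rpow_add_of_nonneg _ _ zero_le_one hq1.le, ENNReal.rpow_one]
          _ ≤ _ := by
              gcongr
              exact min_le_left _ _
      · simp [hx]
    have hIt : I ≠ ∞ := hbound q hq.nonneg
    rcases eq_or_ne I 0 with hI0 | hI0
    · rw [hI0]
      exact zero_le
    have hq0 := hq.pos
    have hq0' := hq.symm.pos
    have hsplit : I = I ^ (1 / q) * I ^ (1 / q') := by
      rw [← ENNReal.rpow_add_of_nonneg _ _ (by positivity) (by positivity), one_div, one_div,
        hq.inv_add_inv_eq_one, ENNReal.rpow_one]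
    have hJ0 : I ^ (1 / q') ≠ 0 := (ENNReal.rpow_pos (pos_iff_ne_zero.2 hI0) hIt).ne'
    have hJt : I ^ (1 / q') ≠ ∞ := ENNReal.rpow_ne_top_of_nonneg (by positivity) hIt
    nth_rewrite 1 [hsplit] at hle
    have hle' := (ENNReal.mul_le_mul_iff_left hJ0 hJt).1 hle
    rwa [one_div, ENNReal.rpow_inv_le_iff hq0] at hle'
  have hlim : Tendsto (fun N : ℕ => ∫⁻ x, (S N).indicator
      (fun x => (min (T x) N) ^ q * ENNReal.ofReal (u x)) x) atTop
      (𝓝 (∫⁻ x, T x ^ q * ENNReal.ofReal (u x))) := by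
    refine lintegral_tendsto_of_tendsto_of_monotone
      (fun N => (Measurable.indicator (by fun_prop) (hSm N)).aemeasurable)
      (ae_of_all _ fun x N N' hN => ?_) (ae_of_all _ fun x => ?_)
    · dsimp only
      by_cases hx : x ∈ S N
      · rw [indicator_of_mem hx, indicator_of_mem (hSmono hN hx)]
        have := hq.nonneg
        gcongr
      · rw [indicator_of_notMem hx]
        exact zero_le
    · have h1 : Tendsto (fun N : ℕ => min (T x) (N : ℝ≥0∞)) atTop (𝓝 (min (T x) ∞)) :=
        tendsto_const_nhds.min ENNReal.tendsto_nat_nhds_top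
      rw [min_eq_left le_top] at h1
      have h2 : Tendsto (fun N : ℕ => (min (T x) (N : ℝ≥0∞)) ^ q * ENNReal.ofReal (u x)) atTop
          (𝓝 (T x ^ q * ENNReal.ofReal (u x))) :=
        ENNReal.Tendsto.mul_const ((ENNReal.continuous_rpow_const.tendsto _).comp h1)
          (Or.inr ENNReal.ofReal_ne_top)
      refine h2.congr' ?_
      obtain ⟨N₀, hN₀⟩ := exists_nat_gt (max ‖x‖ (u x))
      filter_upwards [eventually_ge_atTop N₀] with N hN
      have hx : x ∈ S N₀ := ⟨?_, ?_⟩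
      · rw [indicator_of_mem (hSmono hN hx)]
      · simpa using (le_max_left _ _).trans_lt hN₀
      · exact ((le_max_right _ _).trans_lt hN₀).le
  exact le_of_tendsto' hlim htrunc

/-! ### Passage to measurable representatives and conclusion -/

theorem luxNorm_congr {Φ : ℝ → ℝ} {Q : Set (EuclideanSpace ℝ (Fin n))}
    {f g : EuclideanSpace ℝ (Fin n) → ℝ} (h : f =ᵐ[volume] g) :
    luxNorm Φ Q f = luxNorm Φ Q g := by
  have : ∀ r : ℝ, ∫⁻ x in Q, ENNReal.ofReal (Φ (|f x| / r)) =
      ∫⁻ x in Q, ENNReal.ofReal (Φ (|g x| / r)) := fun r =>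
    lintegral_congr_ae ((ae_restrict_of_ae h).mono fun x hx => by dsimp only; rw [hx])
  simp only [luxNorm, this]

theorem bumpConst_congr {α p q : ℝ} {A B : ℝ → ℝ} {u u' σ σ' : EuclideanSpace ℝ (Fin n) → ℝ}
    (hu : u =ᵐ[volume] u') (hσ : σ =ᵐ[volume] σ') :
    bumpConst α p q A B u σ = bumpConst α p q A B u' σ' := by
  have h1 : ∀ Q, luxNorm A Q (fun x => u x ^ (1 / q)) = luxNorm A Q (fun x => u' x ^ (1 / q)) :=
    fun Q => luxNorm_congr (hu.mono fun x hx => by dsimp only; rw [hx])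
  have h2 : ∀ Q, luxNorm B Q (fun x => σ x ^ (1 / p.conjExponent)) =
      luxNorm B Q (fun x => σ' x ^ (1 / p.conjExponent)) :=
    fun Q => luxNorm_congr (hσ.mono fun x hx => by dsimp only; rw [hx])
  simp only [bumpConst, h1, h2]

theorem IsWeight.exists_measurable {w : EuclideanSpace ℝ (Fin n) → ℝ} (hw : IsWeight w) :
    ∃ v : EuclideanSpace ℝ (Fin n) → ℝ, Measurable v ∧ (∀ x, 0 ≤ v x) ∧ w =ᵐ[volume] v :=
  ⟨fun x => max (hw.aemeasurable.mk w x) 0, hw.aemeasurable.measurable_mk.max measurable_const,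
    fun x => le_max_right _ _, hw.aemeasurable.ae_eq_mk.mono fun x hx => by
      dsimp only
      rw [← hx, max_eq_left (hw.nonneg x)]⟩

theorem weightMeasure_congr {w v : EuclideanSpace ℝ (Fin n) → ℝ} (h : w =ᵐ[volume] v) :
    weightMeasure w = weightMeasure v :=
  withDensity_congr_ae (h.mono fun x hx => by dsimp only; rw [hx])

theorem lintegral_weightMeasure {v : EuclideanSpace ℝ (Fin n) → ℝ} (hv : Measurable v)
    {h : EuclideanSpace ℝ (Fin n) → ℝ≥0∞} (hh : Measurable h) :
    ∫⁻ x, h x ∂weightMeasure v = ∫⁻ x, h x * ENNReal.ofReal (v x) := by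
  rw [weightMeasure, lintegral_withDensity_eq_lintegral_mul _ (by fun_prop) hh]
  exact lintegral_congr fun x => mul_comm _ _

theorem fracKernel_congr {𝕜 : Type*} [RCLike 𝕜] {α : ℝ} {f g : EuclideanSpace ℝ (Fin n) → 𝕜}
    (h : f =ᵐ[volume] g) (x : EuclideanSpace ℝ (Fin n)) :
    fracKernel α f x =ᵐ[volume] fracKernel α g x :=
  h.mono fun y hy => by rw [fracKernel, fracKernel, hy]

theorem fracIntegral_congr {𝕜 : Type*} [RCLike 𝕜] {α : ℝ} {f g : EuclideanSpace ℝ (Fin n) → 𝕜}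
    (h : f =ᵐ[volume] g) : fracIntegral α f = fracIntegral α g :=
  funext fun x => integral_congr_ae (fracKernel_congr h x)

/-- Equality `σ dx`-almost everywhere says nothing where `σ = 0`, but there both products vanish. -/
theorem smul_ae_eq_of_ae_eq_weightMeasure {𝕜 : Type*} [RCLike 𝕜]
    {σ v : EuclideanSpace ℝ (Fin n) → ℝ} (hv : Measurable v) (hv0 : ∀ x, 0 ≤ v x)
    (hσ : σ =ᵐ[volume] v) {f g : EuclideanSpace ℝ (Fin n) → 𝕜} (h : f =ᵐ[weightMeasure σ] g) :
    (fun y => σ y • f y) =ᵐ[volume] fun y => v y • g y := by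
  rw [weightMeasure_congr hσ, weightMeasure, EventuallyEq,
    ae_withDensity_iff (by fun_prop)] at h
  filter_upwards [h, hσ] with y hy hy'
  rw [hy']
  rcases (hv0 y).eq_or_lt with h0 | h0
  · rw [← h0, zero_smul, zero_smul]
  · rw [hy (by simpa using h0)]

/-- The bilinear bound and duality are applied to `T = I_α(|f|σ)`, a nonnegative integral that may
be infinite. Its finite `L^q(u)` norm gives absolute convergence `u`-almost everywhere, and `T`
dominates `|I_α(fσ)|`. -/
theorem exists_fracIntegral_le {𝕜 : Type*} [RCLike 𝕜] {α p q : ℝ} (hα : 0 < α) (hαn : α < n)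
    (hp : 1 < p) (hpq : p ≤ q) {A B : ℝ → ℝ} (hA : IsYoung A) (hB : IsYoung B)
    (hA' : SatisfiesBp q.conjExponent (associate A)) (hB' : SatisfiesBp p (associate B)) :
    ∃ C : ℝ≥0, ∀ u σ : EuclideanSpace ℝ (Fin n) → ℝ, Measurable u → (∀ x, 0 ≤ u x) →
      Measurable σ → (∀ x, 0 ≤ σ x) → bumpConst α p q A B u σ < ∞ →
      ∀ f : EuclideanSpace ℝ (Fin n) → 𝕜, Measurable f →
        eLpNorm f (ENNReal.ofReal p) (weightMeasure σ) < ∞ →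
        (∀ᵐ x ∂(weightMeasure u), Integrable (fracKernel α (fun y => σ y • f y) x) volume) ∧
        AEStronglyMeasurable (fracIntegral α (fun y => σ y • f y)) (weightMeasure u) ∧
        eLpNorm (fracIntegral α (fun y => σ y • f y)) (ENNReal.ofReal q) (weightMeasure u) ≤
          C * bumpConst α p q A B u σ * eLpNorm f (ENNReal.ofReal p) (weightMeasure σ) := by
  obtain ⟨C, hC⟩ := exists_bilinear_le hα hαn hp hpq hA hB hA' hB'
  refine ⟨C, fun u σ hu hu0 hσ hσ0 hbump f hf hfp => ?_⟩
  have hq : 1 < q := hp.trans_le hpq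
  have hp0 : 0 < p := one_pos.trans hp
  have hq0 : 0 < q := one_pos.trans hq
  set K := C * bumpConst α p q A B u σ * eLpNorm f (ENNReal.ofReal p) (weightMeasure σ) with hK
  have hKt : K ≠ ∞ := by finiteness
  have hnorm : eLpNorm f (ENNReal.ofReal p) (weightMeasure σ) =
      (∫⁻ x, ENNReal.ofReal (‖f x‖ ^ p * σ x)) ^ (1 / p) := by
    rw [eLpNorm_eq_lintegral_rpow_enorm_toReal (by simpa using hp0) ENNReal.ofReal_ne_top,
      ENNReal.toReal_ofReal hp0.le, lintegral_weightMeasure hσ (by fun_prop)]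
    congr 1
    refine lintegral_congr fun x => ?_
    rw [ENNReal.ofReal_mul (by positivity), ← ENNReal.ofReal_rpow_of_nonneg (norm_nonneg _) hp0.le,
      ofReal_norm]
  set T : EuclideanSpace ℝ (Fin n) → ℝ≥0∞ := fun x =>
    ∫⁻ y, ENNReal.ofReal ((‖x - y‖ ^ ((n : ℝ) - α))⁻¹) * ENNReal.ofReal (‖f y‖ * σ y) with hTdef
  have hTm : Measurable T := by
    refine Measurable.lintegral_prod_right' (f := fun z : EuclideanSpace ℝ (Fin n) ×
      EuclideanSpace ℝ (Fin n) => ENNReal.ofReal ((‖z.1 - z.2‖ ^ ((n : ℝ) - α))⁻¹) *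
        ENNReal.ofReal (‖f z.2‖ * σ z.2)) ?_
    fun_prop
  have hTK : ∫⁻ x, T x ^ q * ENNReal.ofReal (u x) ≤ K ^ q := by
    refine lintegral_rpow_mul_le_of_duality (Real.HolderConjugate.conjExponent hq) hTm hu
      fun g hg hg0 hgu => ?_
    rw [hK, hnorm]
    exact hC u σ (fun y => ‖f y‖) g hu hu0 hσ hσ0 hf.norm (fun y => norm_nonneg _) hg hg0 hgu
  rw [← lintegral_weightMeasure hu (by fun_prop)] at hTK
  have hkm : Measurable fun z : EuclideanSpace ℝ (Fin n) × EuclideanSpace ℝ (Fin n) =>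
      fracKernel α (fun y => σ y • f y) z.1 z.2 := by
    unfold fracKernel
    fun_prop
  have henorm : ∀ x, ∫⁻ y, ‖fracKernel α (fun y => σ y • f y) x y‖ₑ = T x := by
    intro x
    refine lintegral_congr fun y => ?_
    rw [fracKernel, ← ENNReal.ofReal_mul (by positivity), ← ofReal_norm, norm_smul, norm_smul,
      Real.norm_of_nonneg (hσ0 y), Real.norm_of_nonneg (by positivity), mul_comm (σ y)]
  have hTfin : ∀ᵐ x ∂weightMeasure u, T x < ∞ := by
    have := ae_lt_top (hTm.pow_const q)
      (hTK.trans_lt (ENNReal.rpow_lt_top_of_nonneg hq0.le hKt)).ne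
    filter_upwards [this] with x hx
    exact (ENNReal.rpow_lt_top_iff_of_pos hq0).1 hx
  refine ⟨?_, ?_, ?_⟩
  · filter_upwards [hTfin] with x hx
    refine ⟨(hkm.comp measurable_prodMk_left).aestronglyMeasurable, ?_⟩
    rw [HasFiniteIntegral, henorm]
    exact hx
  · exact (StronglyMeasurable.integral_prod_right' hkm.stronglyMeasurable).aestronglyMeasurable
  · rw [eLpNorm_eq_lintegral_rpow_enorm_toReal (by simpa using hq0) ENNReal.ofReal_ne_top,
      ENNReal.toReal_ofReal hq0.le, one_div, ENNReal.rpow_inv_le_iff hq0]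
    refine le_trans (lintegral_mono fun x => ?_) hTK
    gcongr
    rw [← henorm]
    exact enorm_integral_le_lintegral_enorm _

end FracBump

end

theorem mainTheorem4 {𝕜 : Type*} [RCLike 𝕜] (n : ℕ) (α p q : ℝ)
    (hα : 0 < α) (hαn : α < n) (hp : 1 < p) (hpq : p ≤ q)
    (A B : ℝ → ℝ) (hA : FracBump.IsYoung A) (hB : FracBump.IsYoung B)
    (hA' : FracBump.SatisfiesBp q.conjExponent (FracBump.associate A))
    (hB' : FracBump.SatisfiesBp p (FracBump.associate B)) :
    ∃ C : ℝ≥0, ∀ u σ : EuclideanSpace ℝ (Fin n) → ℝ,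
      FracBump.IsWeight u → FracBump.IsWeight σ →
      FracBump.bumpConst α p q A B u σ < ∞ →
      ∀ f : EuclideanSpace ℝ (Fin n) → 𝕜,
        MemLp f (ENNReal.ofReal p) (FracBump.weightMeasure σ) →
        (∀ᵐ x ∂(FracBump.weightMeasure u),
          Integrable (FracBump.fracKernel α (fun y => σ y • f y) x) volume) ∧
        MemLp (FracBump.fracIntegral α (fun y => σ y • f y)) (ENNReal.ofReal q)
          (FracBump.weightMeasure u) ∧
        eLpNorm (FracBump.fracIntegral α (fun y => σ y • f y)) (ENNReal.ofReal q)
            (FracBump.weightMeasure u) ≤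
          C * FracBump.bumpConst α p q A B u σ *
            eLpNorm f (ENNReal.ofReal p) (FracBump.weightMeasure σ) := by
  obtain ⟨C, hC⟩ := FracBump.exists_fracIntegral_le (𝕜 := 𝕜) hα hαn hp hpq hA hB hA' hB'
  refine ⟨C, fun u σ hu hσ hbump f hf => ?_⟩
  obtain ⟨u', hum, hu0, huu⟩ := hu.exists_measurable
  obtain ⟨σ', hσm, hσ0, hσσ⟩ := hσ.exists_measurable
  obtain ⟨f', hfm, hf'⟩ := hf.aestronglyMeasurable
  have hfσ := FracBump.smul_ae_eq_of_ae_eq_weightMeasure hσm hσ0 hσσ hf'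
  have hlt := hf.eLpNorm_lt_top
  rw [eLpNorm_congr_ae hf'] at hlt ⊢
  rw [FracBump.weightMeasure_congr huu, FracBump.fracIntegral_congr hfσ]
  rw [FracBump.bumpConst_congr huu hσσ] at hbump ⊢
  rw [FracBump.weightMeasure_congr hσσ] at hlt ⊢
  obtain ⟨h1, h2, h3⟩ := hC u' σ' hum hu0 hσm hσ0 hbump f' hfm.measurable hlt
  exact ⟨h1.mono fun x hx => hx.congr (FracBump.fracKernel_congr hfσ x).symm,
    ⟨h2, h3.trans_lt (by finiteness)⟩, h3⟩
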